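/- Let $m,k_B>0$, and let $\varphi\ge 0$ be a measurable internal state density on $(0,\infty)$ such that $A(T)=\int_0^\infty e^{-I/(k_BT)}\varphi(I)\,dI<\infty$ for every $T>0$. Put $\varepsilon^K_E(T)=\frac32\frac{k_B}{m}T$ and $\varepsilon^I_E(T)=\frac1m\int_0^\infty I\,\frac{e^{-I/(k_BT)}}{A(T)}\varphi(I)\,dI$. Let $f=f(\boldsymbol\xi,I)\ge 0$, $(\boldsymbol\xi,I)\in\mathbb R^3\times(0,\infty)$, be a distribution function with positive density and finite mass and energy with respect to $\varphi(I)\,dI\,d\boldsymbol\xi$ (for instance the value at a point $(t,\mathbf x)$ of a time- and space-dependent one), and let $$\rho=\iint mf\varphi\,dI\,d\boldsymbol\xi,\quad \rho v_i=\iint m\xi_if\varphi\,dI\,d\boldsymbol\xi,\quad C=\boldsymbol\xi-\mathbf v,\quad \mathsf P_{ij}=\iint mC_iC_jf\varphi\,dI\,d\boldsymbol\xi,$$ $$\varepsilon^K=\frac1\rho\iint\tfrac12mC^2f\varphi\,dI\,d\boldsymbol\xi,\quad \varepsilon^I=\frac1\rho\iint If\varphi\,dI\,d\boldsymbol\xi,\quad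 \varepsilon=\varepsilon^K+\varepsilon^I .$$ Let $T^K$ be given by $\varepsilon^K_E(T^K)=\varepsilon^K$ and $T>0$ by $\varepsilon^K_E(T)+\varepsilon^I_E(T)=\varepsilon$. For $\nu\in[-\frac12,1]$ and $\theta\in[0,1]$ let $$\mathsf T_{ij}=\tfrac23\theta\,\varepsilon^K_E(T)\,\delta_{ij}+(1-\theta)\Big\{\nu\frac{\mathsf P_{ij}}\rho+\tfrac23(1-\nu)\,\varepsilon^K_E(T^K)\,\delta_{ij}\Big\},$$ let $\varepsilon^I_{\rm rel}=\varepsilon-\frac12\mathsf T_{ll}$, and let $T^I_{\rm rel}>0$ be given by $\varepsilon^I_E(T^I_{\rm rel})=\varepsilon^I_{\rm rel}$ (assumed to exist). Put $$\mathscr G=\frac{\rho}{m(2\pi)^{3/2}(\det\mathsf T)^{1/2}}\exp\Big\{-\tfrac12C_i(\mathsf T^{-1})_{ij}C_j\Big\}\cdot\frac1{A(T^I_{\rm rel})}\exp\Big(-\frac I{k_BT^I_{\rm rel}}\Big),\qquad Q(f)=\frac1{\tau_{\rm ES}}(\mathscr G-f),$$ where $\tau_{\rm ES}=\tau_{\rm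 ES}(\rho,T)>0$. Then the H-theorem holds: the entropy production $$\Sigma=-\frac{k_B}{\tau_{\rm ES}}\int_{\mathbb R^3}\int_0^\infty(\mathscr G-f)\log f\;\varphi(I)\,dI\,d\boldsymbol\xi$$ is well defined in $(-\infty,+\infty]$ (with $\log 0=-\infty$) and $\Sigma\ge 0$. If moreover $f>0$ almost everywhere and the integral converges absolutely, then $\Sigma$ is a real number $\ge0$; and if in that case $f=f(t,\mathbf x,\cdot,\cdot)$ at a point $(t,\mathbf x)$ where $f>0$ for all $\boldsymbol\xi$ and $I>0$, where $f$ is differentiable in $t$ and in $\mathbf x$, and where the Boltzmann equation $\partial_tf+\xi_i\,\partial f/\partial x_i=Q(f)$ holds for all $\boldsymbol\xi$ and $I>0$, then, with $H(z)=-k_Bz\log z$, $$\int_{\mathbb R^3}\int_0^\infty\Big(\partial_tH(f)+\xi_i\frac{\partial H(f)}{\partial x_i}\Big)\varphi(I)\,dI\,d\boldsymbol\xi=\Sigma\ge0 .$$ -/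

import Mathlib

open MeasureTheory Set
open scoped ENNReal Matrix

noncomputable section

namespace ESBGK

/-- Vectors of `ℝ³` (positions and molecular velocities), with Lebesgue measure as `volume`. -/
abbrev Vec3 : Type := Fin 3 → ℝ

/-- A pair `(ξ, I)` of a molecular velocity and a microscopic internal energy. -/
abbrev Phase : Type := Vec3 × ℝ

/-- The measure `φ(I) dI` on `(0, ∞)`. -/
def stateMeasure (φ : ℝ → ℝ) : Measure ℝ :=
  (volume.restrict (Ioi 0)).withDensity fun I => ENNReal.ofReal (φ I)

/-- The measure `φ(I) dI dξ` on `ℝ³ × (0, ∞)`. -/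
def phaseMeasure (φ : ℝ → ℝ) : Measure Phase :=
  (volume : Measure Vec3).prod (stateMeasure φ)

/-- An internal state density: measurable, non-negative on `(0, ∞)`, with a finite Laplace
transform `∫₀^∞ exp (-s I) φ(I) dI` for every `s > 0`. -/
structure IsStateDensity (φ : ℝ → ℝ) : Prop where
  measurable : Measurable φ
  nonneg : ∀ I : ℝ, 0 < I → 0 ≤ φ I
  laplace : ∀ s : ℝ, 0 < s → Integrable (fun I : ℝ => Real.exp (-s * I)) (stateMeasure φ)

/-- A distribution function: non-negative, with finite mass and energy, and positive density. -/
structure IsDistribution (φ : ℝ → ℝ) (f : Phase → ℝ) : Prop where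
  nonneg : ∀ᵐ p ∂phaseMeasure φ, 0 ≤ f p
  mass : Integrable f (phaseMeasure φ)
  kinetic : Integrable (fun p => (∑ i, p.1 i ^ 2) * f p) (phaseMeasure φ)
  internal : Integrable (fun p => p.2 * f p) (phaseMeasure φ)
  pos : 0 < ∫ p, f p ∂phaseMeasure φ

/-! ### Caloric equations of state -/

/-- The partition function `A(T) = ∫₀^∞ exp (-I / (k_B T)) φ(I) dI`. -/
def partitionFn (kB : ℝ) (φ : ℝ → ℝ) (T : ℝ) : ℝ :=
  ∫ I, Real.exp (-(I / (kB * T))) ∂stateMeasure φ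

/-- Equilibrium specific translational energy `ε^K_E(T) = (3/2) (k_B/m) T`. -/
def kineticEq (m kB T : ℝ) : ℝ := 3 / 2 * (kB / m) * T

/-- Equilibrium specific energy of the internal modes,
`ε^I_E(T) = (1/m) ∫₀^∞ I f^(I)(I) φ(I) dI` with `f^(I) = exp (-I / (k_B T)) / A(T)`. -/
def internalEq (m kB : ℝ) (φ : ℝ → ℝ) (T : ℝ) : ℝ :=
  1 / m * ∫ I, I * (1 / partitionFn kB φ T * Real.exp (-(I / (kB * T)))) ∂stateMeasure φ

/-! ### Macroscopic quantities of a distribution function -/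

/-- Mass density `ρ`. -/
def density (m : ℝ) (φ : ℝ → ℝ) (f : Phase → ℝ) : ℝ :=
  ∫ p, m * f p ∂phaseMeasure φ

/-- Bulk velocity `v`, given by `ρ v_i = ∫∫ m ξ_i f φ dI dξ`. -/
def velocity (m : ℝ) (φ : ℝ → ℝ) (f : Phase → ℝ) : Vec3 := fun i =>
  1 / density m φ f * ∫ p, m * p.1 i * f p ∂phaseMeasure φ

/-- Peculiar velocity `C = ξ - v`. -/
def peculiar (m : ℝ) (φ : ℝ → ℝ) (f : Phase → ℝ) (ξ : Vec3) : Vec3 :=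
  ξ - velocity m φ f

/-- Pressure tensor `P_ij = ∫∫ m C_i C_j f φ dI dξ`. -/
def pressure (m : ℝ) (φ : ℝ → ℝ) (f : Phase → ℝ) : Matrix (Fin 3) (Fin 3) ℝ :=
  Matrix.of fun i j =>
    ∫ p, m * peculiar m φ f p.1 i * peculiar m φ f p.1 j * f p ∂phaseMeasure φ

/-- Specific translational energy `ε^K`. -/
def kineticEnergy (m : ℝ) (φ : ℝ → ℝ) (f : Phase → ℝ) : ℝ :=
  1 / density m φ f *
    ∫ p, 1 / 2 * m * (∑ i, peculiar m φ f p.1 i ^ 2) * f p ∂phaseMeasure φ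

/-- Specific energy of the internal modes `ε^I`. -/
def internalEnergy (m : ℝ) (φ : ℝ → ℝ) (f : Phase → ℝ) : ℝ :=
  1 / density m φ f * ∫ p, p.2 * f p ∂phaseMeasure φ

/-- Specific total internal energy `ε = ε^K + ε^I`. -/
def totalEnergy (m : ℝ) (φ : ℝ → ℝ) (f : Phase → ℝ) : ℝ :=
  kineticEnergy m φ f + internalEnergy m φ f

/-- Translational temperature `T^K`, the solution of `ε^K_E(T^K) = ε^K`. -/
def kineticTemp (m kB : ℝ) (φ : ℝ → ℝ) (f : Phase → ℝ) : ℝ :=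
  2 * kineticEnergy m φ f / (3 * (kB / m))

/-- `T` is the temperature of `f`: `T > 0` and `ε^K_E(T) + ε^I_E(T) = ε`. -/
def IsTemperature (m kB : ℝ) (φ : ℝ → ℝ) (f : Phase → ℝ) (T : ℝ) : Prop :=
  0 < T ∧ kineticEq m kB T + internalEq m kB φ T = totalEnergy m φ f

/-! ### The ES-BGK model -/

/-- The tensor `𝖳_ij = (2/3) θ ε^K_E(T) δ_ij
+ (1 - θ) {ν P_ij / ρ + (2/3) (1 - ν) ε^K_E(T^K) δ_ij}`. -/
def relaxTensor (m kB : ℝ) (φ : ℝ → ℝ) (ν θ : ℝ) (f : Phase → ℝ) (T : ℝ) :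
    Matrix (Fin 3) (Fin 3) ℝ :=
  (2 / 3 * θ * kineticEq m kB T) • (1 : Matrix (Fin 3) (Fin 3) ℝ) +
    (1 - θ) • (ν • ((1 / density m φ f) • pressure m φ f) +
      (2 / 3 * (1 - ν) * kineticEq m kB (kineticTemp m kB φ f)) •
        (1 : Matrix (Fin 3) (Fin 3) ℝ))

/-- The relaxation internal energy `ε^I_rel`: the specific energy of the internal modes of `𝒢`.
The translational energy of `𝒢` is `𝖳_ll / 2` and `𝒢` has the same total energy as `f`, so
`𝖳_ll / 2 + ε^I_rel = ε`. -/
def relaxInternalEnergy (m kB : ℝ) (φ : ℝ → ℝ) (ν θ : ℝ) (f : Phase → ℝ) (T : ℝ) : ℝ :=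
  totalEnergy m φ f - 1 / 2 * (relaxTensor m kB φ ν θ f T).trace

/-- `T'` is the relaxation temperature `T^I_rel`: `T' > 0` and `ε^I_E(T') = ε^I_rel`. -/
def IsRelaxTemperature (m kB : ℝ) (φ : ℝ → ℝ) (ν θ : ℝ) (f : Phase → ℝ) (T T' : ℝ) : Prop :=
  0 < T' ∧ internalEq m kB φ T' = relaxInternalEnergy m kB φ ν θ f T

/-- The factor `𝒢^(K)`, an anisotropic Gaussian in `ξ - v` with covariance `𝖳`. -/
def gaussK (m kB : ℝ) (φ : ℝ → ℝ) (ν θ : ℝ) (f : Phase → ℝ) (T : ℝ) (ξ : Vec3) : ℝ :=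
  density m φ f /
      (m * (2 * Real.pi) ^ (3 / 2 : ℝ) * (relaxTensor m kB φ ν θ f T).det ^ (1 / 2 : ℝ)) *
    Real.exp (-(1 / 2) *
      (peculiar m φ f ξ ⬝ᵥ ((relaxTensor m kB φ ν θ f T)⁻¹ *ᵥ peculiar m φ f ξ)))

/-- The factor `𝒢^(I)` at relaxation temperature `T'`. -/
def gaussI (kB : ℝ) (φ : ℝ → ℝ) (T' I : ℝ) : ℝ :=
  1 / partitionFn kB φ T' * Real.exp (-(I / (kB * T')))

/-- The distribution `𝒢 = 𝒢^(K) 𝒢^(I)`. -/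
def gauss (m kB : ℝ) (φ : ℝ → ℝ) (ν θ : ℝ) (f : Phase → ℝ) (T T' : ℝ) (p : Phase) : ℝ :=
  gaussK m kB φ ν θ f T p.1 * gaussI kB φ T' p.2

/-- The collision term `Q(f) = (𝒢 - f) / τ_ES`, where `τ_ES = τ_ES(ρ, T)`. -/
def collision (m kB : ℝ) (φ : ℝ → ℝ) (ν θ : ℝ) (τES : ℝ → ℝ → ℝ) (f : Phase → ℝ) (T T' : ℝ)
    (p : Phase) : ℝ :=
  1 / τES (density m φ f) T * (gauss m kB φ ν θ f T T' p - f p)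

/-- The equation `∂f/∂t + ξ_i ∂f/∂x_i = q` at the point `(t, x)` for all `ξ` and all `I > 0`. -/
def KineticEquationAt (F : ℝ → Vec3 → Phase → ℝ) (q : Phase → ℝ) (t : ℝ) (x : Vec3) : Prop :=
  ∀ (ξ : Vec3) (I : ℝ), 0 < I →
    DifferentiableAt ℝ (fun s => F s x (ξ, I)) t ∧
    DifferentiableAt ℝ (fun y => F t y (ξ, I)) x ∧
    deriv (fun s => F s x (ξ, I)) t + fderiv ℝ (fun y => F t y (ξ, I)) x ξ = q (ξ, I)

/-! ### Entropy production -/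

/-- `H(z) = -k_B z log z`. -/
def entropyFn (kB z : ℝ) : ℝ := -kB * (z * Real.log z)

/-- The integral of an extended-real function, as integral of the positive part minus integral
of the negative part. It is `⊥` whenever the negative part has an infinite integral. -/
def extIntegral (μ : Measure Phase) (g : Phase → EReal) : EReal :=
  ((∫⁻ p, (g p).toENNReal ∂μ : ℝ≥0∞) : EReal) - ((∫⁻ p, (-g p).toENNReal ∂μ : ℝ≥0∞) : EReal)

/-- The entropy production `Σ = -(k_B / τ_ES) ∫∫ (𝒢 - f) log f φ dI dξ` as an extended real
number, with the convention `log 0 = -∞`. -/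
def extProduction (m kB : ℝ) (φ : ℝ → ℝ) (ν θ : ℝ) (τES : ℝ → ℝ → ℝ) (f : Phase → ℝ)
    (T T' : ℝ) : EReal :=
  ((1 / τES (density m φ f) T * kB : ℝ) : EReal) *
    extIntegral (phaseMeasure φ) fun p =>
      -(((gauss m kB φ ν θ f T T' p - f p : ℝ) : EReal) * ENNReal.log (ENNReal.ofReal (f p)))

/-- The entropy production `Σ = -(k_B / τ_ES) ∫∫ (𝒢 - f) log f φ dI dξ` as a real integral. -/
def production (m kB : ℝ) (φ : ℝ → ℝ) (ν θ : ℝ) (τES : ℝ → ℝ → ℝ) (f : Phase → ℝ)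
    (T T' : ℝ) : ℝ :=
  -(1 / τES (density m φ f) T) * kB *
    ∫ p, (gauss m kB φ ν θ f T T' p - f p) * Real.log (f p) ∂phaseMeasure φ

end ESBGK

end

/-!
Write `n = ∫ f` for the number density, `Θ = P / ρ` for the velocity covariance of `f`, and let `M`
be the Gaussian with covariance `Θ` times the internal Gibbs factor of `𝒢` at `T'`, normalized to
the same mass. All three densities `f`, `𝒢`, `M` have integral `n`. Applying `log z ≤ z - 1` to
`M / f` and to `f / 𝒢` gives the pointwise bound

  `-(𝒢 - f) log f ≥ (f log M - M) - (𝒢 log 𝒢 - 𝒢)`,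

whose right-hand side (`minorant`) is integrable, since `log M` and `log 𝒢` are affine in `I` and
quadratic in `ξ`. This already shows that the negative part of the integrand has a finite integral.
The integral of the right-hand side is explicit: with `s = k_B T / m` and `s' = k_B T' / m` it equals

  `(n / 2) (log det 𝖳 - log det Θ - θ (3 s - tr Θ) / s')`.

Comparing with `M` rather than with `𝒢` alone matters for `ν < 0`, where
`∫ (f - 𝒢) log 𝒢` can be negative; giving `M` the temperature `T'` avoids asking for a temperature
at which `ε^I_E` equals `ε^I`, which need not exist.

That the last expression is non-negative rests on two facts.
* `log_det_relaxTensor_ge`: `log det 𝖳 ≥ log det Θ + θ (3 - tr Θ / s)`. For `ν ∈ [-1/2, 1]` every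
  eigenvalue of `𝖳` is a convex combination of `s`, one eigenvalue of `Θ` and the mean of the other
  two, so that this is concavity of the logarithm (`sum_log_relax_eigenvalue_ge`).
* `relaxTemperature_comparison`: `(3 s - tr Θ) / s' ≤ (3 s - tr Θ) / s`. Energy conservation gives
  `ε^I_E(T') - ε^I_E(T) = (1 - θ) (3 s - tr Θ) / 2`, and `ε^I_E` is strictly increasing
  (`internalEq_strictMonoOn`), so `T' - T` and `3 s - tr Θ` do not have opposite signs.

The entropy balance is the chain rule (`entropy_chain_rule`) together with `∫ 𝒢 = ∫ f`.
-/

namespace ESBGK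

/-! ### The extended-real integral -/

theorem extIntegral_coe {μ : Measure Phase} {g : Phase → EReal} {r : Phase → ℝ}
    (hr : Integrable r μ) (hg : ∀ᵐ p ∂μ, g p = (r p : EReal)) :
    extIntegral μ g = ((∫ p, r p ∂μ : ℝ) : EReal) := by
  have h1 : ∫⁻ p, (g p).toENNReal ∂μ = ∫⁻ p, ENNReal.ofReal (r p) ∂μ :=
    lintegral_congr_ae (by filter_upwards [hg] with p hp; rw [hp, EReal.real_coe_toENNReal])
  have h2 : ∫⁻ p, (-g p).toENNReal ∂μ = ∫⁻ p, ENNReal.ofReal (-r p) ∂μ :=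
    lintegral_congr_ae (by
      filter_upwards [hg] with p hp; rw [hp, ← EReal.coe_neg, EReal.real_coe_toENNReal])
  have h3 : ∫⁻ p, ENNReal.ofReal (r p) ∂μ ≠ ⊤ := hr.lintegral_lt_top.ne
  have h4 : ∫⁻ p, ENNReal.ofReal (-r p) ∂μ ≠ ⊤ := hr.neg.lintegral_lt_top.ne
  rw [extIntegral, h1, h2, integral_eq_lintegral_pos_part_sub_lintegral_neg_part hr,
    EReal.coe_sub, EReal.coe_ennreal_toReal h3, EReal.coe_ennreal_toReal h4]

/-- An integrable real minorant with non-negative integral makes the extended integral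
well defined (its negative part is finite) and non-negative. -/
theorem extIntegral_nonneg_of_minorant {μ : Measure Phase} {g : Phase → EReal} {r : Phase → ℝ}
    (hr : Integrable r μ) (hg : ∀ᵐ p ∂μ, (r p : EReal) ≤ g p) (h0 : 0 ≤ ∫ p, r p ∂μ) :
    0 ≤ extIntegral μ g := by
  have h1 : ∫⁻ p, ENNReal.ofReal (r p) ∂μ ≤ ∫⁻ p, (g p).toENNReal ∂μ :=
    lintegral_mono_ae (by
      filter_upwards [hg] with p hp
      rw [← EReal.real_coe_toENNReal]; exact EReal.toENNReal_le_toENNReal hp)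
  have h2 : ∫⁻ p, (-g p).toENNReal ∂μ ≤ ∫⁻ p, ENNReal.ofReal (-r p) ∂μ :=
    lintegral_mono_ae (by
      filter_upwards [hg] with p hp
      rw [← EReal.real_coe_toENNReal, EReal.coe_neg]
      exact EReal.toENNReal_le_toENNReal (EReal.neg_le_neg_iff.2 hp))
  have h3 : ∫⁻ p, ENNReal.ofReal (r p) ∂μ ≠ ⊤ := hr.lintegral_lt_top.ne
  have h4 : ∫⁻ p, ENNReal.ofReal (-r p) ∂μ ≠ ⊤ := hr.neg.lintegral_lt_top.ne
  rw [integral_eq_lintegral_pos_part_sub_lintegral_neg_part hr, sub_nonneg,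
    ENNReal.toReal_le_toReal h4 h3] at h0
  rw [extIntegral]
  refine EReal.sub_nonneg ?_ ?_ |>.2 ?_
  · right; exact fun h => (h2.trans_lt h4.lt_top).ne (EReal.coe_ennreal_eq_top_iff.1 h)
  · right; exact EReal.coe_ennreal_ne_bot _
  · exact_mod_cast h2.trans (h0.trans h1)

/-! ### Gaussian integrals -/

section Gaussian

variable {ι : Type*} [Fintype ι]

theorem integrable_exp_neg_half_sq : Integrable fun x : ℝ => Real.exp (-(1 / 2) * x ^ 2) :=
  integrable_exp_neg_mul_sq (by norm_num)

theorem integrable_sq_mul_exp_neg_half_sq :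
    Integrable fun x : ℝ => x ^ 2 * Real.exp (-(1 / 2) * x ^ 2) := by
  have h := integrable_rpow_mul_exp_neg_mul_sq (b := 1 / 2) (by norm_num) (s := 2) (by norm_num)
  simpa [Real.rpow_two] using h

theorem integral_exp_neg_half_sq :
    ∫ x : ℝ, Real.exp (-(1 / 2) * x ^ 2) = √(2 * Real.pi) := by
  rw [integral_gaussian]; congr 1; ring

theorem integral_sq_mul_exp_neg_half_sq :
    ∫ x : ℝ, x ^ 2 * Real.exp (-(1 / 2) * x ^ 2) = √(2 * Real.pi) := by
  have h := ProbabilityTheory.variance_id_gaussianReal (μ := 0) (v := 1)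
  rw [ProbabilityTheory.variance_eq_integral measurable_id.aemeasurable] at h
  simp only [id, ProbabilityTheory.integral_id_gaussianReal, sub_zero] at h
  rw [ProbabilityTheory.integral_gaussianReal_eq_integral_smul one_ne_zero] at h
  have hpos : 0 < √(2 * Real.pi) := by positivity
  simp only [ProbabilityTheory.gaussianPDFReal, smul_eq_mul, NNReal.coe_one, mul_one, sub_zero]
    at h
  have h2 : ∀ x : ℝ, (√(2 * Real.pi))⁻¹ * Real.exp (-x ^ 2 / 2) * x ^ 2
      = (√(2 * Real.pi))⁻¹ * (x ^ 2 * Real.exp (-(1 / 2) * x ^ 2)) := by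
    intro x; rw [show -x ^ 2 / 2 = -(1 / 2) * x ^ 2 by ring]; ring
  simp only [h2, integral_const_mul] at h
  rwa [inv_mul_eq_one₀ hpos.ne', eq_comm] at h

theorem exp_neg_half_dotProduct (y : ι → ℝ) :
    Real.exp (-(1 / 2) * (y ⬝ᵥ y)) = ∏ i, Real.exp (-(1 / 2) * y i ^ 2) := by
  rw [← Real.exp_sum, dotProduct, Finset.mul_sum]
  simp only [sq]

theorem integrable_stdGaussian : Integrable fun y : ι → ℝ => Real.exp (-(1 / 2) * (y ⬝ᵥ y)) := by
  simp only [exp_neg_half_dotProduct]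
  exact Integrable.fintype_prod fun _ => integrable_exp_neg_half_sq

theorem integral_stdGaussian :
    ∫ y : ι → ℝ, Real.exp (-(1 / 2) * (y ⬝ᵥ y)) = √(2 * Real.pi) ^ Fintype.card ι := by
  simp only [exp_neg_half_dotProduct]
  rw [integral_fintype_prod_volume_eq_prod (fun _ x => Real.exp (-(1 / 2) * x ^ 2))]
  simp only [integral_exp_neg_half_sq, Finset.prod_const, Finset.card_univ]

variable [DecidableEq ι]

theorem dotProduct_mul_exp (y : ι → ℝ) :
    (y ⬝ᵥ y) * Real.exp (-(1 / 2) * (y ⬝ᵥ y))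
      = ∑ k, ∏ i, (if i = k then y i ^ 2 else 1) * Real.exp (-(1 / 2) * y i ^ 2) := by
  simp only [Finset.prod_mul_distrib, Finset.prod_ite_eq', Finset.mem_univ, if_true]
  rw [exp_neg_half_dotProduct, dotProduct, Finset.sum_mul]
  simp only [sq]

theorem integrable_ite_sq_mul_exp (p : Prop) [Decidable p] :
    Integrable fun x : ℝ => (if p then x ^ 2 else 1) * Real.exp (-(1 / 2) * x ^ 2) := by
  split_ifs
  · exact integrable_sq_mul_exp_neg_half_sq
  · simpa using integrable_exp_neg_half_sq

theorem integral_ite_sq_mul_exp (p : Prop) [Decidable p] :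
    ∫ x : ℝ, (if p then x ^ 2 else 1) * Real.exp (-(1 / 2) * x ^ 2) = √(2 * Real.pi) := by
  split_ifs
  · exact integral_sq_mul_exp_neg_half_sq
  · simpa using integral_exp_neg_half_sq

theorem integrable_dotProduct_mul_stdGaussian :
    Integrable fun y : ι → ℝ => (y ⬝ᵥ y) * Real.exp (-(1 / 2) * (y ⬝ᵥ y)) := by
  simp only [dotProduct_mul_exp]
  exact integrable_finsetSum _ fun k _ => Integrable.fintype_prod
    (f := fun i x => (if i = k then x ^ 2 else 1) * Real.exp (-(1 / 2) * x ^ 2))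
    fun i => integrable_ite_sq_mul_exp _

theorem integral_dotProduct_mul_stdGaussian :
    ∫ y : ι → ℝ, (y ⬝ᵥ y) * Real.exp (-(1 / 2) * (y ⬝ᵥ y))
      = Fintype.card ι * √(2 * Real.pi) ^ Fintype.card ι := by
  simp only [dotProduct_mul_exp]
  rw [integral_finsetSum]
  · have h (k : ι) : ∫ y : ι → ℝ,
        ∏ i, (if i = k then y i ^ 2 else 1) * Real.exp (-(1 / 2) * y i ^ 2)
          = √(2 * Real.pi) ^ Fintype.card ι := by
      rw [integral_fintype_prod_volume_eq_prod
        (fun i x => (if i = k then x ^ 2 else 1) * Real.exp (-(1 / 2) * x ^ 2))]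
      simp only [integral_ite_sq_mul_exp, Finset.prod_const, Finset.card_univ]
    simp only [h, Finset.sum_const, Finset.card_univ, nsmul_eq_mul]
  · exact fun k _ => Integrable.fintype_prod
      (f := fun i x => (if i = k then x ^ 2 else 1) * Real.exp (-(1 / 2) * x ^ 2))
      fun i => integrable_ite_sq_mul_exp _

theorem integrable_comp_inv_mulVec {B : Matrix ι ι ℝ} (hB : B.det ≠ 0) {g : (ι → ℝ) → ℝ}
    (hg : Integrable g) : Integrable fun x => g (B⁻¹ *ᵥ x) := by
  have hdet : B⁻¹.det ≠ 0 := by rw [Matrix.det_nonsing_inv]; simpa using hB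
  have h := Real.map_matrix_volume_pi_eq_smul_volume_pi hdet
  have h1 : Integrable g (Measure.map (Matrix.toLin' B⁻¹) volume) := by
    rw [h]; exact hg.smul_measure ENNReal.ofReal_ne_top
  exact h1.comp_measurable (Matrix.toLin' B⁻¹).continuous_of_finiteDimensional.measurable

theorem integral_comp_inv_mulVec {B : Matrix ι ι ℝ} (hB : B.det ≠ 0) {g : (ι → ℝ) → ℝ}
    (hg : Integrable g) : ∫ x, g (B⁻¹ *ᵥ x) = |B.det| * ∫ x, g x := by
  have hdet : B⁻¹.det ≠ 0 := by rw [Matrix.det_nonsing_inv]; simpa using hB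
  have h := Real.map_matrix_volume_pi_eq_smul_volume_pi hdet
  have h1 : Integrable g (Measure.map (Matrix.toLin' B⁻¹) volume) := by
    rw [h]; exact hg.smul_measure ENNReal.ofReal_ne_top
  have h2 := integral_map
    (Matrix.toLin' B⁻¹).continuous_of_finiteDimensional.measurable.aemeasurable
    h1.aestronglyMeasurable
  rw [h, integral_smul_measure, ENNReal.toReal_ofReal (abs_nonneg _)] at h2
  simp only [Matrix.toLin'_apply, smul_eq_mul] at h2
  rw [← h2, Matrix.det_nonsing_inv]
  simp

theorem dotProduct_inv_mulVec_eq {B : Matrix ι ι ℝ} (x : ι → ℝ) :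
    x ⬝ᵥ ((B * Bᵀ)⁻¹ *ᵥ x) = (B⁻¹ *ᵥ x) ⬝ᵥ (B⁻¹ *ᵥ x) := by
  rw [Matrix.mul_inv_rev, ← Matrix.mulVec_mulVec, ← Matrix.transpose_nonsing_inv,
    Matrix.dotProduct_mulVec, Matrix.vecMul_transpose]

/-- The unnormalized centred Gaussian with covariance matrix `S`. -/
noncomputable def gaussianFn (S : Matrix ι ι ℝ) (x : ι → ℝ) : ℝ :=
  Real.exp (-(1 / 2) * (x ⬝ᵥ (S⁻¹ *ᵥ x)))

/-- A matrix of the form `S = B Bᵀ` with `B` invertible, i.e. a covariance matrix of a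
non-degenerate Gaussian, presented by the linear map that transforms it to the standard one. -/
def IsCov (S : Matrix ι ι ℝ) : Prop := ∃ B : Matrix ι ι ℝ, B.det ≠ 0 ∧ S = B * Bᵀ

variable {S : Matrix ι ι ℝ}

theorem IsCov.det_pos (hS : IsCov S) : 0 < S.det := by
  obtain ⟨B, hB, rfl⟩ := hS
  rw [Matrix.det_mul, Matrix.det_transpose]
  exact mul_self_pos.2 hB

theorem IsCov.integrable_gaussianFn (hS : IsCov S) : Integrable (gaussianFn S) := by
  obtain ⟨B, hB, rfl⟩ := hS
  refine (integrable_comp_inv_mulVec hB integrable_stdGaussian).congr (.of_forall fun x => ?_)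
  simp only [gaussianFn, dotProduct_inv_mulVec_eq]

theorem IsCov.integral_gaussianFn (hS : IsCov S) :
    ∫ x, gaussianFn S x = √S.det * √(2 * Real.pi) ^ Fintype.card ι := by
  obtain ⟨B, hB, rfl⟩ := hS
  simp only [gaussianFn, dotProduct_inv_mulVec_eq]
  rw [integral_comp_inv_mulVec hB integrable_stdGaussian, integral_stdGaussian, Matrix.det_mul,
    Matrix.det_transpose, Real.sqrt_mul_self_eq_abs]

theorem IsCov.integrable_quadratic_mul_gaussianFn (hS : IsCov S) :
    Integrable fun x => (x ⬝ᵥ (S⁻¹ *ᵥ x)) * gaussianFn S x := by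
  obtain ⟨B, hB, rfl⟩ := hS
  simp only [gaussianFn, dotProduct_inv_mulVec_eq]
  exact integrable_comp_inv_mulVec hB integrable_dotProduct_mul_stdGaussian

theorem IsCov.integral_quadratic_mul_gaussianFn (hS : IsCov S) :
    ∫ x, (x ⬝ᵥ (S⁻¹ *ᵥ x)) * gaussianFn S x
      = Fintype.card ι * (√S.det * √(2 * Real.pi) ^ Fintype.card ι) := by
  obtain ⟨B, hB, rfl⟩ := hS
  simp only [gaussianFn, dotProduct_inv_mulVec_eq]
  rw [integral_comp_inv_mulVec hB integrable_dotProduct_mul_stdGaussian,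
    integral_dotProduct_mul_stdGaussian, Matrix.det_mul, Matrix.det_transpose,
    Real.sqrt_mul_self_eq_abs]
  ring

end Gaussian

/-! ### Spectral calculus for `a + b Θ` -/

section Spectral

variable {ι : Type*} [Fintype ι] [DecidableEq ι]

theorem smul_one_add_smul_eq_conj {A : Matrix ι ι ℝ} (hA : A.IsHermitian) (a b : ℝ) :
    ∃ U : Matrix ι ι ℝ, U * Uᵀ = 1 ∧
      a • (1 : Matrix ι ι ℝ) + b • A
        = U * Matrix.diagonal (fun i => a + b * hA.eigenvalues i) * Uᵀ := by
  have hs := hA.spectral_theorem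
  rw [Unitary.conjStarAlgAut_apply] at hs
  set U : Matrix ι ι ℝ := (hA.eigenvectorUnitary : Matrix ι ι ℝ) with hU
  have hstar : star U = Uᵀ := by
    rw [Matrix.star_eq_conjTranspose, Matrix.conjTranspose_eq_transpose_of_trivial]
  have hUU : U * Uᵀ = 1 := by
    rw [← hstar]; exact Unitary.coe_mul_star_self hA.eigenvectorUnitary
  refine ⟨U, hUU, ?_⟩
  have hd : Matrix.diagonal (fun i => a + b * hA.eigenvalues i)
      = a • (1 : Matrix ι ι ℝ) + b • Matrix.diagonal hA.eigenvalues := by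
    ext i j
    by_cases h : i = j <;> simp [Matrix.diagonal, h]
  rw [hd, Matrix.mul_add, Matrix.add_mul, Matrix.mul_smul, Matrix.smul_mul, Matrix.mul_one, hUU,
    Matrix.mul_smul, Matrix.smul_mul]
  conv_lhs => rw [hs]
  rw [← hstar]
  rfl

theorem det_smul_one_add_smul {A : Matrix ι ι ℝ} (hA : A.IsHermitian) (a b : ℝ) :
    (a • (1 : Matrix ι ι ℝ) + b • A).det = ∏ i, (a + b * hA.eigenvalues i) := by
  obtain ⟨U, hU, h⟩ := smul_one_add_smul_eq_conj hA a b
  rw [h, Matrix.det_mul_right_comm, hU, Matrix.one_mul, Matrix.det_diagonal]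

theorem isCov_smul_one_add_smul {A : Matrix ι ι ℝ} (hA : A.IsHermitian) {a b : ℝ}
    (hab : ∀ i, 0 < a + b * hA.eigenvalues i) : IsCov (a • (1 : Matrix ι ι ℝ) + b • A) := by
  have hdet : 0 < (a • (1 : Matrix ι ι ℝ) + b • A).det := by
    rw [det_smul_one_add_smul hA]; exact Finset.prod_pos fun i _ => hab i
  obtain ⟨U, hU, h⟩ := smul_one_add_smul_eq_conj hA a b
  have hB : a • (1 : Matrix ι ι ℝ) + b • A
      = (U * Matrix.diagonal fun i => √(a + b * hA.eigenvalues i)) *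
        (U * Matrix.diagonal fun i => √(a + b * hA.eigenvalues i))ᵀ := by
    rw [h, Matrix.transpose_mul, Matrix.diagonal_transpose, ← Matrix.mul_assoc,
      Matrix.mul_assoc U (Matrix.diagonal _) (Matrix.diagonal _), Matrix.diagonal_mul_diagonal]
    simp only [Real.mul_self_sqrt (hab _).le]
  refine ⟨_, fun h0 => ?_, hB⟩
  rw [hB, Matrix.det_mul, h0, zero_mul] at hdet
  exact hdet.false

theorem _root_.Matrix.PosDef.isCov {A : Matrix ι ι ℝ} (hA : A.PosDef) : IsCov A := by
  have h := isCov_smul_one_add_smul (a := 0) (b := 1) hA.isHermitian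
    (fun i => by simpa using hA.eigenvalues_pos i)
  simpa using h

theorem IsCov.sum_inv_mul {S : Matrix ι ι ℝ} (hS : IsCov S) :
    ∑ i, ∑ j, S⁻¹ i j * S i j = Fintype.card ι := by
  have hT : Sᵀ = S := by
    obtain ⟨B, -, rfl⟩ := hS
    rw [Matrix.transpose_mul, Matrix.transpose_transpose]
  have h : (S⁻¹ * S).trace = Fintype.card ι := by
    rw [Matrix.nonsing_inv_mul S (isUnit_iff_ne_zero.2 hS.det_pos.ne'), Matrix.trace_one]
  rw [← h, Matrix.trace]
  refine Finset.sum_congr rfl fun i _ => ?_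
  rw [Matrix.diag_apply, Matrix.mul_apply]
  refine Finset.sum_congr rfl fun j _ => ?_
  conv_lhs => rw [← hT]
  rw [Matrix.transpose_apply, hT]

end Spectral

/-! ### The logarithmic determinant inequality -/

/-- Concavity of the logarithm at four points, one of the weights being shared. -/
theorem le_log_mix {θ t x y z s : ℝ} (hθ : θ ∈ Icc (0 : ℝ) 1) (ht : t ∈ Icc (0 : ℝ) 1)
    (hx : 0 < x) (hy : 0 < y) (hz : 0 < z) (hs : 0 < s) :
    (1 - θ) * (t * Real.log x + (1 - t) / 2 * (Real.log y + Real.log z)) + θ * Real.log s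
      ≤ Real.log ((1 - θ) * (t * x + (1 - t) / 2 * (y + z)) + θ * s) := by
  have hc : ConcaveOn ℝ (Ioi 0) Real.log := strictConcaveOn_log_Ioi.concaveOn
  obtain ⟨hθ0, hθ1⟩ := hθ
  obtain ⟨ht0, ht1⟩ := ht
  have h1 := hc.2 (mem_Ioi.2 hy) (mem_Ioi.2 hz) (by norm_num : (0 : ℝ) ≤ 1 / 2)
    (by norm_num : (0 : ℝ) ≤ 1 / 2) (by norm_num)
  simp only [smul_eq_mul] at h1
  have hw : 0 < 1 / 2 * y + 1 / 2 * z := by positivity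
  have h2 := hc.2 (mem_Ioi.2 hx) (mem_Ioi.2 hw) ht0 (sub_nonneg.2 ht1) (by ring)
  simp only [smul_eq_mul] at h2
  have hv : 0 < t * x + (1 - t) * (1 / 2 * y + 1 / 2 * z) :=
    hc.1 (mem_Ioi.2 hx) (mem_Ioi.2 hw) ht0 (sub_nonneg.2 ht1) (by ring)
  have h3 := hc.2 (mem_Ioi.2 hv) (mem_Ioi.2 hs) (sub_nonneg.2 hθ1) hθ0 (by ring)
  simp only [smul_eq_mul] at h3
  have h4 : t * x + (1 - t) / 2 * (y + z) = t * x + (1 - t) * (1 / 2 * y + 1 / 2 * z) := by ring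
  rw [h4]
  refine le_trans ?_ h3
  have h5 := mul_le_mul_of_nonneg_left h1 (sub_nonneg.2 ht1)
  have h6 := mul_le_mul_of_nonneg_left
    (show t * Real.log x + (1 - t) / 2 * (Real.log y + Real.log z)
      ≤ Real.log (t * x + (1 - t) * (1 / 2 * y + 1 / 2 * z)) by linarith) (sub_nonneg.2 hθ1)
  linarith

theorem relax_eigenvalue_eq (θ ν s : ℝ) (l : Fin 3 → ℝ) (i : Fin 3) :
    θ * s + (1 - θ) * (1 - ν) * ((∑ k, l k) / 3) + (1 - θ) * ν * l i
      = (1 - θ) * ((2 * ν + 1) / 3 * l i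
          + (1 - (2 * ν + 1) / 3) / 2 * (l (i + 1) + l (i + 2))) + θ * s := by
  fin_cases i <;> simp [Fin.sum_univ_three] <;> ring_nf

theorem relax_eigenvalue_pos {θ ν s : ℝ} (hν : ν ∈ Icc (-(1 / 2) : ℝ) 1)
    (hθ : θ ∈ Icc (0 : ℝ) 1) (hs : 0 < s) {l : Fin 3 → ℝ} (hl : ∀ i, 0 < l i) (i : Fin 3) :
    0 < θ * s + (1 - θ) * (1 - ν) * ((∑ k, l k) / 3) + (1 - θ) * ν * l i := by
  rw [relax_eigenvalue_eq]
  have hc : Convex ℝ (Ioi (0 : ℝ)) := convex_Ioi 0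
  have hw : 0 < 1 / 2 * l (i + 1) + 1 / 2 * l (i + 2) := by
    have := hl (i + 1); have := hl (i + 2); positivity
  have ht0 : 0 ≤ (2 * ν + 1) / 3 := by linarith [hν.1]
  have ht1 : 0 ≤ 1 - (2 * ν + 1) / 3 := by linarith [hν.2]
  have h1 := hc (mem_Ioi.2 (hl i)) (mem_Ioi.2 hw) ht0 ht1 (by ring)
  have h2 := hc h1 (mem_Ioi.2 hs) (sub_nonneg.2 hθ.2) hθ.1 (by ring)
  simp only [smul_eq_mul, mem_Ioi] at h2
  exact h2.trans_eq (by ring)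

/-- With `l` the eigenvalues of `P / ρ` and `s = k_B T / m`, the left side is `log det 𝖳`. For
`ν ∈ [-1/2, 1]` each eigenvalue of `𝖳` is a convex combination of `s`, `l i` and the mean of the
other two eigenvalues, so the bound is concavity of the logarithm together with
`log (s / l i) ≥ 1 - l i / s`. -/
theorem sum_log_relax_eigenvalue_ge {θ ν s : ℝ} (hν : ν ∈ Icc (-(1 / 2) : ℝ) 1)
    (hθ : θ ∈ Icc (0 : ℝ) 1) (hs : 0 < s) {l : Fin 3 → ℝ} (hl : ∀ i, 0 < l i) :
    ∑ i, Real.log (l i) + θ * (3 - (∑ k, l k) / s)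
      ≤ ∑ i, Real.log
          (θ * s + (1 - θ) * (1 - ν) * ((∑ k, l k) / 3) + (1 - θ) * ν * l i) := by
  have ht : (2 * ν + 1) / 3 ∈ Icc (0 : ℝ) 1 :=
    ⟨by linarith [hν.1], by linarith [hν.2]⟩
  have h1 : ∀ i : Fin 3, _ := fun i =>
    le_log_mix hθ ht (hl i) (hl (i + 1)) (hl (i + 2)) hs
  simp only [relax_eigenvalue_eq]
  refine le_trans ?_ (Finset.sum_le_sum fun i _ => h1 i)
  have h2 : ∀ i, 1 - l i / s ≤ Real.log s - Real.log (l i) := fun i => by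
    have := Real.one_sub_inv_le_log_of_pos (div_pos hs (hl i))
    rwa [inv_div, Real.log_div hs.ne' (hl i).ne'] at this
  have h3 : 3 - (∑ k, l k) / s ≤ 3 * Real.log s - ∑ i, Real.log (l i) := by
    have := add_le_add (add_le_add (h2 0) (h2 1)) (h2 2)
    simp only [Fin.sum_univ_three, add_div]
    linarith
  have h4 := mul_le_mul_of_nonneg_left h3 hθ.1
  refine (add_le_add_right h4 _).trans (le_of_eq ?_)
  simp [Fin.sum_univ_three]
  ring_nf

/-! ### The internal energy distribution -/

instance (φ : ℝ → ℝ) : SFinite (stateMeasure φ) := by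
  unfold stateMeasure; infer_instance

theorem ae_stateMeasure_pos (φ : ℝ → ℝ) : ∀ᵐ I ∂stateMeasure φ, 0 < I :=
  (withDensity_absolutelyContinuous _ _).ae_le (ae_restrict_mem measurableSet_Ioi)

theorem ae_stateMeasure_ne (φ : ℝ → ℝ) (c : ℝ) : ∀ᵐ I ∂stateMeasure φ, I ≠ c :=
  ((withDensity_absolutelyContinuous _ _).trans Measure.restrict_le_self.absolutelyContinuous).ae_le
    (Measure.ae_ne volume c)

theorem integral_stateMeasure_pos {φ : ℝ → ℝ} (h0 : stateMeasure φ ≠ 0) {g : ℝ → ℝ} (c : ℝ)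
    (hg : Integrable g (stateMeasure φ)) (hpos : ∀ I, I ≠ c → 0 < g I) :
    0 < ∫ I, g I ∂stateMeasure φ := by
  have hae : ∀ᵐ I ∂stateMeasure φ, 0 < g I :=
    (ae_stateMeasure_ne φ c).mono fun I hI => hpos I hI
  have hnn : 0 ≤ᵐ[stateMeasure φ] g := hae.mono fun I hI => hI.le
  refine (integral_nonneg_of_ae hnn).lt_of_ne fun h => ?_
  have hz := (integral_eq_zero_iff_of_nonneg_ae hnn hg).1 h.symm
  have hF : ∀ᵐ _ ∂stateMeasure φ, False := by
    filter_upwards [hae, hz] with I h1 h2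
    exact h1.ne' h2
  exact h0 (ae_eq_bot.1 (Filter.eventually_false_iff_eq_bot.1 hF))

section InternalEnergy

variable {φ : ℝ → ℝ}

theorem IsStateDensity.integrable_mul_exp (hφ : IsStateDensity φ) {s : ℝ} (hs : 0 < s) :
    Integrable (fun I : ℝ => I * Real.exp (-s * I)) (stateMeasure φ) := by
  refine ((hφ.laplace (s / 2) (half_pos hs)).const_mul (2 / s)).mono'
    (by fun_prop) ?_
  filter_upwards [ae_stateMeasure_pos φ] with I hI
  rw [Real.norm_of_nonneg (by positivity)]
  have h1 : s / 2 * I ≤ Real.exp (s / 2 * I) := by linarith [Real.add_one_le_exp (s / 2 * I)]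
  have h2 : I ≤ 2 / s * Real.exp (s / 2 * I) := by
    calc I = 2 / s * (s / 2 * I) := by field_simp
      _ ≤ _ := by gcongr
  calc I * Real.exp (-s * I) ≤ 2 / s * Real.exp (s / 2 * I) * Real.exp (-s * I) := by gcongr
    _ = 2 / s * Real.exp (-(s / 2) * I) := by
      rw [mul_assoc, ← Real.exp_add]; ring_nf

theorem IsStateDensity.integral_exp_pos (hφ : IsStateDensity φ) (h0 : stateMeasure φ ≠ 0) {s : ℝ}
    (hs : 0 < s) : 0 < ∫ I, Real.exp (-s * I) ∂stateMeasure φ :=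
  integral_stateMeasure_pos h0 0 (hφ.laplace s hs) fun _ _ => Real.exp_pos _

/-- The mean energy of the Gibbs law is strictly decreasing in the inverse temperature: with `c`
the mean at `s`, the integral of `(I - c) e^{-rI}` is that of
`(I - c) e^{-sI} (e^{(s-r)I} - e^{(s-r)c})`, whose integrand is positive off `I = c`. -/
theorem IsStateDensity.mean_lt_mean (hφ : IsStateDensity φ) (h0 : stateMeasure φ ≠ 0) {r s : ℝ}
    (hr : 0 < r) (hrs : r < s) :
    (∫ I, I * Real.exp (-s * I) ∂stateMeasure φ) / ∫ I, Real.exp (-s * I) ∂stateMeasure φ <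
      (∫ I, I * Real.exp (-r * I) ∂stateMeasure φ) / ∫ I, Real.exp (-r * I) ∂stateMeasure φ := by
  have hs := hr.trans hrs
  have As := hφ.integral_exp_pos h0 hs
  have Ar := hφ.integral_exp_pos h0 hr
  set c := (∫ I, I * Real.exp (-s * I) ∂stateMeasure φ) /
    ∫ I, Real.exp (-s * I) ∂stateMeasure φ with hc
  have hcs : ∫ I, I * Real.exp (-s * I) ∂stateMeasure φ
      = c * ∫ I, Real.exp (-s * I) ∂stateMeasure φ := by
    rw [hc, div_mul_cancel₀ _ As.ne']
  have hint : ∀ {q : ℝ}, 0 < q →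
      Integrable (fun I => I * Real.exp (-q * I) - c * Real.exp (-q * I)) (stateMeasure φ) :=
    fun hq => (hφ.integrable_mul_exp hq).sub ((hφ.laplace _ hq).const_mul c)
  have hval : ∀ {q : ℝ}, 0 < q →
      ∫ I, (I * Real.exp (-q * I) - c * Real.exp (-q * I)) ∂stateMeasure φ
        = (∫ I, I * Real.exp (-q * I) ∂stateMeasure φ)
          - c * ∫ I, Real.exp (-q * I) ∂stateMeasure φ := fun hq => by
    rw [integral_sub (hφ.integrable_mul_exp hq) ((hφ.laplace _ hq).const_mul c),
      integral_const_mul]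
  have hpos := integral_stateMeasure_pos h0 c
    ((hint hr).sub ((hint hs).const_mul (Real.exp ((s - r) * c)))) (fun I hI => by
      have he : Real.exp (-r * I) = Real.exp (-s * I) * Real.exp ((s - r) * I) := by
        rw [← Real.exp_add]; ring_nf
      have hfac : (I * Real.exp (-r * I) - c * Real.exp (-r * I))
          - Real.exp ((s - r) * c) * (I * Real.exp (-s * I) - c * Real.exp (-s * I))
          = Real.exp (-s * I) *
            ((I - c) * (Real.exp ((s - r) * I) - Real.exp ((s - r) * c))) := by
        rw [he]; ring
      simp only [Pi.sub_apply]
      rw [hfac]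
      refine mul_pos (Real.exp_pos _) ?_
      rcases hI.lt_or_gt with h | h
      · refine mul_pos_of_neg_of_neg (sub_neg.2 h) (sub_neg.2 (Real.exp_lt_exp.2 ?_))
        exact mul_lt_mul_of_pos_left h (sub_pos.2 hrs)
      · refine mul_pos (sub_pos.2 h) (sub_pos.2 (Real.exp_lt_exp.2 ?_))
        exact mul_lt_mul_of_pos_left h (sub_pos.2 hrs))
  simp only [Pi.sub_apply] at hpos
  rw [integral_sub (hint hr) ((hint hs).const_mul _), integral_const_mul, hval hr, hval hs, hcs,
    sub_self, mul_zero, sub_zero] at hpos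
  rw [lt_div_iff₀ Ar]
  linarith

theorem exp_gibbs_eq (kB T I : ℝ) :
    Real.exp (-(I / (kB * T))) = Real.exp (-(1 / (kB * T)) * I) := by
  congr 1; ring

theorem internalEq_eq (m kB : ℝ) (φ : ℝ → ℝ) (T : ℝ) :
    internalEq m kB φ T = 1 / m *
      ((∫ I, I * Real.exp (-(1 / (kB * T)) * I) ∂stateMeasure φ) /
        ∫ I, Real.exp (-(1 / (kB * T)) * I) ∂stateMeasure φ) := by
  simp only [internalEq, partitionFn, exp_gibbs_eq]
  have h (c I : ℝ) : I * (1 / c * Real.exp (-(1 / (kB * T)) * I))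
      = 1 / c * (I * Real.exp (-(1 / (kB * T)) * I)) := by ring
  simp only [h]
  rw [integral_const_mul]
  ring

theorem internalEq_strictMonoOn {m kB : ℝ} (hm : 0 < m) (hkB : 0 < kB) (hφ : IsStateDensity φ)
    (h0 : stateMeasure φ ≠ 0) : StrictMonoOn (internalEq m kB φ) (Ioi 0) := by
  intro T hT T' hT' hlt
  rw [mem_Ioi] at hT hT'
  rw [internalEq_eq, internalEq_eq]
  refine mul_lt_mul_of_pos_left (hφ.mean_lt_mean h0 (by positivity) ?_) (by positivity)
  exact one_div_lt_one_div_of_lt (by positivity) (mul_lt_mul_of_pos_left hlt hkB)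

theorem partitionFn_pos {kB T : ℝ} (hkB : 0 < kB) (hT : 0 < T) (hφ : IsStateDensity φ)
    (h0 : stateMeasure φ ≠ 0) : 0 < partitionFn kB φ T := by
  simp only [partitionFn, exp_gibbs_eq]
  exact hφ.integral_exp_pos h0 (by positivity)

theorem integrable_gaussI {kB T : ℝ} (hkB : 0 < kB) (hT : 0 < T) (hφ : IsStateDensity φ) :
    Integrable (gaussI kB φ T) (stateMeasure φ) := by
  have h := (hφ.laplace (1 / (kB * T)) (by positivity)).const_mul (1 / partitionFn kB φ T)
  refine h.congr (.of_forall fun I => ?_)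
  simp only [gaussI, exp_gibbs_eq]

theorem integral_gaussI {kB T : ℝ} (hkB : 0 < kB) (hT : 0 < T) (hφ : IsStateDensity φ)
    (h0 : stateMeasure φ ≠ 0) : ∫ I, gaussI kB φ T I ∂stateMeasure φ = 1 := by
  have h := partitionFn_pos hkB hT hφ h0
  simp only [gaussI]
  rw [integral_const_mul]
  change 1 / partitionFn kB φ T * partitionFn kB φ T = 1
  field_simp

theorem integrable_mul_gaussI {kB T : ℝ} (hkB : 0 < kB) (hT : 0 < T) (hφ : IsStateDensity φ) :
    Integrable (fun I => I * gaussI kB φ T I) (stateMeasure φ) := by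
  have h := (hφ.integrable_mul_exp (s := 1 / (kB * T)) (by positivity)).const_mul
    (1 / partitionFn kB φ T)
  refine h.congr (.of_forall fun I => ?_)
  simp only [gaussI, exp_gibbs_eq]
  ring

theorem integral_mul_gaussI {m : ℝ} (hm : 0 < m) (kB T : ℝ) (φ : ℝ → ℝ) :
    ∫ I, I * gaussI kB φ T I ∂stateMeasure φ = m * internalEq m kB φ T := by
  simp only [internalEq, gaussI]
  field_simp

end InternalEnergy

/-! ### Moments of a distribution function -/

section Moments

variable {φ : ℝ → ℝ} {f : Phase → ℝ} {m : ℝ}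

theorem ae_phaseMeasure_pos (φ : ℝ → ℝ) : ∀ᵐ p ∂phaseMeasure φ, 0 < p.2 :=
  Measure.quasiMeasurePreserving_snd.ae (ae_stateMeasure_pos φ)

theorem IsDistribution.stateMeasure_ne_zero (hf : IsDistribution φ f) : stateMeasure φ ≠ 0 := by
  intro h
  have := hf.pos
  simp [phaseMeasure, h] at this

theorem density_eq (m : ℝ) (φ : ℝ → ℝ) (f : Phase → ℝ) :
    density m φ f = m * ∫ p, f p ∂phaseMeasure φ := by
  rw [density, integral_const_mul]

theorem IsDistribution.density_pos (hf : IsDistribution φ f) (hm : 0 < m) :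
    0 < density m φ f := by
  rw [density_eq]; exact mul_pos hm hf.pos

theorem IsDistribution.integrable_mul_of_bound (hf : IsDistribution φ f) {h : Vec3 → ℝ}
    (hh : Continuous h) {a b : ℝ} (hb : ∀ ξ, |h ξ| ≤ a + b * ∑ i, ξ i ^ 2) :
    Integrable (fun p => h p.1 * f p) (phaseMeasure φ) := by
  refine ((hf.mass.const_mul a).add (hf.kinetic.const_mul b)).mono'
    ((hh.comp continuous_fst).aestronglyMeasurable.mul hf.mass.aestronglyMeasurable) ?_
  filter_upwards [hf.nonneg] with p hp
  rw [norm_mul, Real.norm_eq_abs, Real.norm_of_nonneg hp]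
  have := mul_le_mul_of_nonneg_right (hb p.1) hp
  simp only [Pi.add_apply]
  linarith

theorem IsDistribution.integrable_sub_mul_sub (hf : IsDistribution φ f) (v : Vec3) (i j : Fin 3) :
    Integrable (fun p => (p.1 i - v i) * (p.1 j - v j) * f p) (phaseMeasure φ) := by
  refine hf.integrable_mul_of_bound (h := fun ξ => (ξ i - v i) * (ξ j - v j)) (by fun_prop)
    (a := v i ^ 2 + v j ^ 2) (b := 2) fun ξ => ?_
  have h1 : ∀ k, ξ k ^ 2 ≤ ∑ l, ξ l ^ 2 := fun k =>
    Finset.single_le_sum (f := fun l => ξ l ^ 2) (fun l _ => sq_nonneg _) (Finset.mem_univ k)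
  have h2 := h1 i
  have h3 := h1 j
  rw [abs_le]
  constructor <;>
    nlinarith [sq_nonneg (ξ i - v i + (ξ j - v j)), sq_nonneg (ξ i - v i - (ξ j - v j)),
      sq_nonneg (ξ i + v i), sq_nonneg (ξ j + v j)]

theorem IsDistribution.integral_sub_mul_sub (hm : 0 < m) (i j : Fin 3) :
    ∫ p, (p.1 i - velocity m φ f i) * (p.1 j - velocity m φ f j) * f p ∂phaseMeasure φ
      = pressure m φ f i j / m := by
  rw [eq_div_iff hm.ne', mul_comm, ← integral_const_mul]
  simp only [pressure, Matrix.of_apply, peculiar, Pi.sub_apply]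
  congr 1; funext p; ring

theorem dotProduct_mulVec_eq_sum (Q : Matrix (Fin 3) (Fin 3) ℝ) (x : Vec3) :
    x ⬝ᵥ (Q *ᵥ x) = ∑ i, ∑ j, Q i j * (x i * x j) := by
  simp only [dotProduct, Matrix.mulVec, Finset.mul_sum]
  exact Finset.sum_congr rfl fun i _ => Finset.sum_congr rfl fun j _ => by ring

theorem IsDistribution.integrable_quadratic (hf : IsDistribution φ f) (v : Vec3)
    (Q : Matrix (Fin 3) (Fin 3) ℝ) :
    Integrable (fun p => (p.1 - v) ⬝ᵥ (Q *ᵥ (p.1 - v)) * f p) (phaseMeasure φ) := by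
  have h := integrable_finsetSum (μ := phaseMeasure φ) Finset.univ fun i _ =>
    integrable_finsetSum (μ := phaseMeasure φ) Finset.univ fun j _ =>
      (hf.integrable_sub_mul_sub v i j).const_mul (Q i j)
  refine h.congr (.of_forall fun p => ?_)
  simp only [dotProduct_mulVec_eq_sum, Finset.sum_mul, Pi.sub_apply]
  exact Finset.sum_congr rfl fun i _ => Finset.sum_congr rfl fun j _ => by ring

theorem IsDistribution.integral_quadratic (hf : IsDistribution φ f) (hm : 0 < m)
    (Q : Matrix (Fin 3) (Fin 3) ℝ) :
    ∫ p, (p.1 - velocity m φ f) ⬝ᵥ (Q *ᵥ (p.1 - velocity m φ f)) * f p ∂phaseMeasure φ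
      = (∑ i, ∑ j, Q i j * pressure m φ f i j) / m := by
  have h : ∀ p : Phase,
      (p.1 - velocity m φ f) ⬝ᵥ (Q *ᵥ (p.1 - velocity m φ f)) * f p
        = ∑ i, ∑ j, Q i j *
          ((p.1 i - velocity m φ f i) * (p.1 j - velocity m φ f j) * f p) := fun p => by
    simp only [dotProduct_mulVec_eq_sum, Finset.sum_mul, Pi.sub_apply]
    exact Finset.sum_congr rfl fun i _ => Finset.sum_congr rfl fun j _ => by ring
  have hij (i j : Fin 3) : Integrable (fun p : Phase => Q i j *
      ((p.1 i - velocity m φ f i) * (p.1 j - velocity m φ f j) * f p)) (phaseMeasure φ) :=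
    (hf.integrable_sub_mul_sub _ i j).const_mul _
  simp only [h]
  rw [integral_finsetSum, Finset.sum_div]
  · refine Finset.sum_congr rfl fun i _ => ?_
    rw [integral_finsetSum _ fun j _ => hij i j, Finset.sum_div]
    refine Finset.sum_congr rfl fun j _ => ?_
    rw [integral_const_mul, IsDistribution.integral_sub_mul_sub hm, mul_div_assoc]
  · exact fun i _ => integrable_finsetSum _ fun j _ => hij i j

/-- The velocity covariance `P / ρ`. -/
noncomputable def covariance (m : ℝ) (φ : ℝ → ℝ) (f : Phase → ℝ) : Matrix (Fin 3) (Fin 3) ℝ :=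
  (1 / density m φ f) • pressure m φ f

theorem volume_dotProduct_eq_zero {x : Vec3} (hx : x ≠ 0) (c : ℝ) :
    ∀ᵐ ξ : Vec3, x ⬝ᵥ ξ ≠ c := by
  obtain ⟨i, hi⟩ := Function.ne_iff.1 hx
  let L : Vec3 →ᵃ[ℝ] ℝ := (dotProductBilin ℝ ℝ x).toAffineMap
  let s : AffineSubspace ℝ Vec3 := (AffineSubspace.mk' c ⊥).comap L
  have hs : s ≠ ⊤ := by
    intro h
    have h1 : ∀ y : Vec3, x ⬝ᵥ y = c := fun y => by
      have hy : y ∈ s := h ▸ AffineSubspace.mem_top ℝ _ y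
      simpa [s, L, sub_eq_zero] using hy
    have h0 := h1 0
    have h2 := h1 (Pi.single i 1)
    simp at h0 h2
    exact hi (by simpa using h2.trans h0.symm)
  have hn := Measure.addHaar_affineSubspace (volume : Measure Vec3) s hs
  rw [ae_iff]
  refine measure_mono_null (fun y hy => ?_) hn
  simp only [ne_eq, not_not, mem_ofPred_eq] at hy
  simp [s, L, hy]

/-- The covariance is non-degenerate because `f` has a density: a null direction `x` would confine
the velocities to a plane `x · (ξ - v) = 0`. -/
theorem IsDistribution.posDef_covariance (hf : IsDistribution φ f) (hm : 0 < m) :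
    (covariance m φ f).PosDef := by
  have hρ := hf.density_pos hm
  refine Matrix.PosDef.smul ?_ (by positivity)
  refine Matrix.PosDef.of_dotProduct_mulVec_pos ?_ fun x hx => ?_
  · ext i j
    simp only [pressure, Matrix.conjTranspose_apply, Matrix.of_apply, star_trivial]
    congr 1; funext p; ring
  · rw [star_trivial, dotProduct_mulVec_eq_sum]
    set v := velocity m φ f with hv
    have hsq : ∀ p : Phase, (x ⬝ᵥ (p.1 - v)) ^ 2 * f p
        = (p.1 - v) ⬝ᵥ (Matrix.vecMulVec x x *ᵥ (p.1 - v)) * f p := fun p => by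
      rw [dotProduct_mulVec_eq_sum, sq, dotProduct, Finset.sum_mul_sum]
      congr 1
      exact Finset.sum_congr rfl fun i _ => Finset.sum_congr rfl fun j _ => by
        rw [Matrix.vecMulVec_apply]; ring
    have hint : Integrable (fun p => (x ⬝ᵥ (p.1 - v)) ^ 2 * f p) (phaseMeasure φ) := by
      simp only [hsq]; exact hf.integrable_quadratic v _
    have hval : ∫ p, (x ⬝ᵥ (p.1 - v)) ^ 2 * f p ∂phaseMeasure φ
        = (∑ i, ∑ j, pressure m φ f i j * (x i * x j)) / m := by
      simp only [hsq]
      rw [hf.integral_quadratic hm]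
      congr 1
      exact Finset.sum_congr rfl fun i _ => Finset.sum_congr rfl fun j _ => by
        rw [Matrix.vecMulVec_apply]; ring
    have hnn : 0 ≤ᵐ[phaseMeasure φ] fun p => (x ⬝ᵥ (p.1 - v)) ^ 2 * f p :=
      hf.nonneg.mono fun p hp => mul_nonneg (sq_nonneg _) hp
    have hpos : 0 < ∫ p, (x ⬝ᵥ (p.1 - v)) ^ 2 * f p ∂phaseMeasure φ := by
      refine (integral_nonneg_of_ae hnn).lt_of_ne fun h => ?_
      have hz := (integral_eq_zero_iff_of_nonneg_ae hnn hint).1 h.symm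
      have hne : ∀ᵐ p ∂phaseMeasure φ, x ⬝ᵥ p.1 ≠ x ⬝ᵥ v :=
        Measure.quasiMeasurePreserving_fst.ae (volume_dotProduct_eq_zero hx _)
      have hf0 : f =ᵐ[phaseMeasure φ] 0 := by
        filter_upwards [hz, hne] with p h1 h2
        refine (mul_eq_zero.1 h1).resolve_left (pow_ne_zero 2 ?_)
        rw [dotProduct_sub]; exact sub_ne_zero.2 h2
      have h1 := hf.pos
      rw [integral_congr_ae hf0] at h1
      simp at h1
    rw [hval] at hpos
    exact (div_pos_iff_of_pos_right hm).1 hpos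

theorem IsDistribution.kineticEnergy_eq (hf : IsDistribution φ f) (hm : 0 < m) :
    kineticEnergy m φ f = 1 / 2 * (covariance m φ f).trace := by
  have h : ∀ p : Phase, 1 / 2 * m * (∑ i, peculiar m φ f p.1 i ^ 2) * f p
      = 1 / 2 * m * ((p.1 - velocity m φ f) ⬝ᵥ
        ((1 : Matrix (Fin 3) (Fin 3) ℝ) *ᵥ (p.1 - velocity m φ f)) * f p) := fun p => by
    simp only [Matrix.one_mulVec, dotProduct, peculiar, sq]
    ring
  rw [kineticEnergy]
  simp only [h]
  rw [integral_const_mul, hf.integral_quadratic hm, covariance, Matrix.trace_smul, Matrix.trace]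
  simp only [Matrix.one_apply, ite_mul, one_mul, zero_mul, Finset.sum_ite_eq, Finset.mem_univ,
    if_true, Matrix.diag_apply, smul_eq_mul]
  field_simp

end Moments

/-! ### Anisotropic Gaussians times Gibbs laws -/

/-- The Gaussian with covariance `S` and mean `v` in the velocity, times the Gibbs law at
temperature `T` in the internal energy, normalized to total number density `n`. -/
noncomputable def gaussGibbs (kB : ℝ) (φ : ℝ → ℝ) (n : ℝ) (v : Vec3)
    (S : Matrix (Fin 3) (Fin 3) ℝ) (T : ℝ) (p : Phase) : ℝ :=
  n / (√S.det * √(2 * Real.pi) ^ 3) * gaussianFn S (p.1 - v) * gaussI kB φ T p.2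

section GaussGibbs

variable {kB : ℝ} {φ : ℝ → ℝ} {n T : ℝ} {v : Vec3} {S : Matrix (Fin 3) (Fin 3) ℝ}

theorem gaussGibbs_pos (hkB : 0 < kB) (hT : 0 < T) (hφ : IsStateDensity φ)
    (h0 : stateMeasure φ ≠ 0) (hn : 0 < n) (hS : IsCov S) (p : Phase) :
    0 < gaussGibbs kB φ n v S T p := by
  have h1 := hS.det_pos
  have h2 := partitionFn_pos hkB hT hφ h0
  unfold gaussGibbs gaussianFn gaussI
  positivity

/-- The constant term of `log gaussGibbs`. -/
noncomputable def gaussGibbsLogConst (kB : ℝ) (φ : ℝ → ℝ) (n : ℝ) (S : Matrix (Fin 3) (Fin 3) ℝ)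
    (T : ℝ) : ℝ :=
  Real.log n - 1 / 2 * Real.log S.det - 3 * Real.log √(2 * Real.pi) -
    Real.log (partitionFn kB φ T)

theorem log_gaussGibbs (hkB : 0 < kB) (hT : 0 < T) (hφ : IsStateDensity φ)
    (h0 : stateMeasure φ ≠ 0) (hn : 0 < n) (hS : IsCov S) (p : Phase) :
    Real.log (gaussGibbs kB φ n v S T p) = gaussGibbsLogConst kB φ n S T
      - 1 / 2 * ((p.1 - v) ⬝ᵥ (S⁻¹ *ᵥ (p.1 - v))) - 1 / (kB * T) * p.2 := by
  have h1 := hS.det_pos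
  have h2 := partitionFn_pos hkB hT hφ h0
  have h3 : 0 < √(2 * Real.pi) := by positivity
  have h4 : 0 < √S.det := Real.sqrt_pos.2 h1
  rw [gaussGibbs, gaussianFn, gaussI, gaussGibbsLogConst,
    Real.log_mul (by positivity) (by positivity),
    Real.log_mul (by positivity) (by positivity), Real.log_mul (by positivity) (by positivity),
    Real.log_div (by positivity) (by positivity), Real.log_mul (by positivity) (by positivity),
    Real.log_pow, Real.log_sqrt h1.le, Real.log_exp, Real.log_exp, Real.log_div one_ne_zero h2.ne',
    Real.log_one]
  push_cast
  ring

theorem integrable_gaussGibbs (hkB : 0 < kB) (hT : 0 < T) (hφ : IsStateDensity φ)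
    (hS : IsCov S) : Integrable (gaussGibbs kB φ n v S T) (phaseMeasure φ) :=
  ((hS.integrable_gaussianFn.comp_sub_right v).const_mul _).mul_prod (integrable_gaussI hkB hT hφ)

theorem integral_gaussGibbs (hkB : 0 < kB) (hT : 0 < T) (hφ : IsStateDensity φ)
    (h0 : stateMeasure φ ≠ 0) (hS : IsCov S) :
    ∫ p, gaussGibbs kB φ n v S T p ∂phaseMeasure φ = n := by
  have h4 : 0 < √S.det := Real.sqrt_pos.2 hS.det_pos
  have h3 : 0 < √(2 * Real.pi) := by positivity
  have h := integral_prod_mul (μ := (volume : Measure Vec3)) (ν := stateMeasure φ)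
    (fun ξ => n / (√S.det * √(2 * Real.pi) ^ 3) * gaussianFn S (ξ - v)) (gaussI kB φ T)
  rw [integral_gaussI hkB hT hφ h0, integral_const_mul,
    integral_sub_right_eq_self (gaussianFn S) v, hS.integral_gaussianFn] at h
  simp only [gaussGibbs, phaseMeasure]
  rw [h, Fintype.card_fin]
  field_simp

theorem integrable_quadratic_mul_gaussGibbs (hkB : 0 < kB) (hT : 0 < T) (hφ : IsStateDensity φ)
    (hS : IsCov S) :
    Integrable (fun p => (p.1 - v) ⬝ᵥ (S⁻¹ *ᵥ (p.1 - v)) * gaussGibbs kB φ n v S T p)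
      (phaseMeasure φ) := by
  have h := ((hS.integrable_quadratic_mul_gaussianFn.comp_sub_right v).const_mul
    (n / (√S.det * √(2 * Real.pi) ^ 3))).mul_prod (integrable_gaussI hkB hT hφ)
  refine h.congr (.of_forall fun p => ?_)
  simp only [gaussGibbs]
  ring

theorem integral_quadratic_mul_gaussGibbs (hkB : 0 < kB) (hT : 0 < T) (hφ : IsStateDensity φ)
    (h0 : stateMeasure φ ≠ 0) (hS : IsCov S) :
    ∫ p, (p.1 - v) ⬝ᵥ (S⁻¹ *ᵥ (p.1 - v)) * gaussGibbs kB φ n v S T p ∂phaseMeasure φ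
      = 3 * n := by
  have h4 : 0 < √S.det := Real.sqrt_pos.2 hS.det_pos
  have h3 : 0 < √(2 * Real.pi) := by positivity
  have h := integral_prod_mul (μ := (volume : Measure Vec3)) (ν := stateMeasure φ)
    (fun ξ => n / (√S.det * √(2 * Real.pi) ^ 3) *
      ((ξ - v) ⬝ᵥ (S⁻¹ *ᵥ (ξ - v)) * gaussianFn S (ξ - v))) (gaussI kB φ T)
  rw [integral_gaussI hkB hT hφ h0, integral_const_mul,
    integral_sub_right_eq_self (fun x => x ⬝ᵥ (S⁻¹ *ᵥ x) * gaussianFn S x) v,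
    hS.integral_quadratic_mul_gaussianFn, Fintype.card_fin] at h
  calc _ = _ := integral_congr_ae (.of_forall fun p => by simp only [gaussGibbs]; ring)
    _ = _ := h
    _ = 3 * n := by push_cast; field_simp

theorem integrable_energy_mul_gaussGibbs (hkB : 0 < kB) (hT : 0 < T) (hφ : IsStateDensity φ)
    (hS : IsCov S) :
    Integrable (fun p => p.2 * gaussGibbs kB φ n v S T p) (phaseMeasure φ) := by
  have h := ((hS.integrable_gaussianFn.comp_sub_right v).const_mul
    (n / (√S.det * √(2 * Real.pi) ^ 3))).mul_prod (integrable_mul_gaussI hkB hT hφ)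
  refine h.congr (.of_forall fun p => ?_)
  simp only [gaussGibbs]
  ring

theorem integral_energy_mul_gaussGibbs {m : ℝ} (hm : 0 < m) (hS : IsCov S) :
    ∫ p, p.2 * gaussGibbs kB φ n v S T p ∂phaseMeasure φ = n * (m * internalEq m kB φ T) := by
  have h4 : 0 < √S.det := Real.sqrt_pos.2 hS.det_pos
  have h3 : 0 < √(2 * Real.pi) := by positivity
  have h := integral_prod_mul (μ := (volume : Measure Vec3)) (ν := stateMeasure φ)
    (fun ξ => n / (√S.det * √(2 * Real.pi) ^ 3) * gaussianFn S (ξ - v))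
    (fun I => I * gaussI kB φ T I)
  rw [integral_mul_gaussI hm, integral_const_mul,
    integral_sub_right_eq_self (gaussianFn S) v, hS.integral_gaussianFn, Fintype.card_fin] at h
  calc _ = _ := integral_congr_ae (.of_forall fun p => by simp only [gaussGibbs]; ring)
    _ = _ := h
    _ = _ := by field_simp

/-- Integrability of `g log gaussGibbs`, for any `g` with the moments entering the logarithm. -/
theorem integrable_mul_log_gaussGibbs (hkB : 0 < kB) (hT : 0 < T) (hφ : IsStateDensity φ)
    (h0 : stateMeasure φ ≠ 0) (hn : 0 < n) (hS : IsCov S) {g : Phase → ℝ}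
    (h1 : Integrable g (phaseMeasure φ))
    (h2 : Integrable (fun p => (p.1 - v) ⬝ᵥ (S⁻¹ *ᵥ (p.1 - v)) * g p) (phaseMeasure φ))
    (h3 : Integrable (fun p => p.2 * g p) (phaseMeasure φ)) :
    Integrable (fun p => g p * Real.log (gaussGibbs kB φ n v S T p)) (phaseMeasure φ) := by
  refine (((h1.const_mul (gaussGibbsLogConst kB φ n S T)).sub (h2.const_mul (1 / 2))).sub
    (h3.const_mul (1 / (kB * T)))).congr (.of_forall fun p => ?_)
  simp only [Pi.sub_apply]
  rw [log_gaussGibbs hkB hT hφ h0 hn hS]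
  ring

theorem integral_mul_log_gaussGibbs (hkB : 0 < kB) (hT : 0 < T) (hφ : IsStateDensity φ)
    (h0 : stateMeasure φ ≠ 0) (hn : 0 < n) (hS : IsCov S) {g : Phase → ℝ}
    (h1 : Integrable g (phaseMeasure φ))
    (h2 : Integrable (fun p => (p.1 - v) ⬝ᵥ (S⁻¹ *ᵥ (p.1 - v)) * g p) (phaseMeasure φ))
    (h3 : Integrable (fun p => p.2 * g p) (phaseMeasure φ)) :
    ∫ p, g p * Real.log (gaussGibbs kB φ n v S T p) ∂phaseMeasure φ
      = gaussGibbsLogConst kB φ n S T * ∫ p, g p ∂phaseMeasure φ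
        - 1 / 2 * ∫ p, (p.1 - v) ⬝ᵥ (S⁻¹ *ᵥ (p.1 - v)) * g p ∂phaseMeasure φ
        - 1 / (kB * T) * ∫ p, p.2 * g p ∂phaseMeasure φ := by
  have h12 : Integrable (fun p => gaussGibbsLogConst kB φ n S T * g p
      - 1 / 2 * ((p.1 - v) ⬝ᵥ (S⁻¹ *ᵥ (p.1 - v)) * g p)) (phaseMeasure φ) :=
    (h1.const_mul _).sub (h2.const_mul _)
  rw [← integral_const_mul, ← integral_const_mul, ← integral_const_mul,
    ← integral_sub (h1.const_mul _) (h2.const_mul _), ← integral_sub h12 (h3.const_mul _)]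
  refine integral_congr_ae (.of_forall fun p => ?_)
  simp only
  rw [log_gaussGibbs hkB hT hφ h0 hn hS]
  ring

end GaussGibbs

/-! ### The relaxation tensor and the target distribution -/

section EntropyProduction

variable {m kB ν θ T T' : ℝ} {φ : ℝ → ℝ} {f : Phase → ℝ}

theorem relaxTensor_eq (hm : 0 < m) (hkB : 0 < kB) (hf : IsDistribution φ f) :
    relaxTensor m kB φ ν θ f T
      = (θ * (kB / m * T) + (1 - θ) * (1 - ν) * ((covariance m φ f).trace / 3)) •
          (1 : Matrix (Fin 3) (Fin 3) ℝ) + ((1 - θ) * ν) • covariance m φ f := by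
  have hK : kineticEq m kB (kineticTemp m kB φ f) = 1 / 2 * (covariance m φ f).trace := by
    rw [kineticEq, kineticTemp, hf.kineticEnergy_eq hm]
    field_simp
  rw [relaxTensor, hK, kineticEq, ← covariance]
  ext i j
  simp only [Matrix.add_apply, Matrix.smul_apply, smul_eq_mul]
  ring

theorem trace_relaxTensor (hm : 0 < m) (hkB : 0 < kB) (hf : IsDistribution φ f) :
    (relaxTensor m kB φ ν θ f T).trace
      = 3 * θ * (kB / m * T) + (1 - θ) * (covariance m φ f).trace := by
  rw [relaxTensor_eq hm hkB hf, Matrix.trace_add, Matrix.trace_smul, Matrix.trace_smul,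
    Matrix.trace_one, Fintype.card_fin]
  simp only [smul_eq_mul]
  push_cast
  ring

theorem isCov_relaxTensor (hm : 0 < m) (hkB : 0 < kB) (hν : ν ∈ Icc (-(1 / 2) : ℝ) 1)
    (hθ : θ ∈ Icc (0 : ℝ) 1) (hT : 0 < T) (hf : IsDistribution φ f) :
    IsCov (relaxTensor m kB φ ν θ f T) := by
  have hΘ := hf.posDef_covariance hm
  rw [relaxTensor_eq hm hkB hf]
  refine isCov_smul_one_add_smul hΘ.isHermitian fun i => ?_
  rw [hΘ.isHermitian.trace_eq_sum_eigenvalues]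
  exact relax_eigenvalue_pos hν hθ (by positivity) hΘ.eigenvalues_pos i

theorem log_det_relaxTensor_ge (hm : 0 < m) (hkB : 0 < kB) (hν : ν ∈ Icc (-(1 / 2) : ℝ) 1)
    (hθ : θ ∈ Icc (0 : ℝ) 1) (hT : 0 < T) (hf : IsDistribution φ f) :
    Real.log (covariance m φ f).det + θ * (3 - (covariance m φ f).trace / (kB / m * T))
      ≤ Real.log (relaxTensor m kB φ ν θ f T).det := by
  have hΘ := hf.posDef_covariance hm
  have hs : 0 < kB / m * T := by positivity
  have hpos := relax_eigenvalue_pos hν hθ hs hΘ.eigenvalues_pos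
  have h := sum_log_relax_eigenvalue_ge hν hθ hs hΘ.eigenvalues_pos
  rw [relaxTensor_eq hm hkB hf, det_smul_one_add_smul hΘ.isHermitian,
    hΘ.isHermitian.det_eq_prod_eigenvalues, hΘ.isHermitian.trace_eq_sum_eigenvalues]
  simp only [RCLike.ofReal_real_eq_id, id]
  rw [Real.log_prod fun i _ => (hΘ.eigenvalues_pos i).ne', Real.log_prod fun i _ => (hpos i).ne']
  exact h

theorem gauss_eq (hm : 0 < m) (p : Phase) :
    gauss m kB φ ν θ f T T' p = gaussGibbs kB φ (∫ q, f q ∂phaseMeasure φ) (velocity m φ f)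
      (relaxTensor m kB φ ν θ f T) T' p := by
  have h2π : (2 * Real.pi) ^ (3 / 2 : ℝ) = √(2 * Real.pi) ^ 3 := by
    rw [Real.sqrt_eq_rpow, ← Real.rpow_natCast, ← Real.rpow_mul (by positivity)]
    norm_num
  rw [gauss, gaussK, gaussGibbs, gaussianFn, h2π, ← Real.sqrt_eq_rpow, density_eq, peculiar]
  congr 2
  rw [mul_assoc, mul_div_mul_left _ _ hm.ne', mul_comm (√(2 * Real.pi) ^ 3)]

theorem internalEq_relaxTemperature (hm : 0 < m) (hkB : 0 < kB) (hf : IsDistribution φ f)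
    (hT' : IsRelaxTemperature m kB φ ν θ f T T') :
    internalEq m kB φ T' - internalEnergy m φ f
      = 1 / 2 * θ * ((covariance m φ f).trace - 3 * (kB / m * T)) := by
  rw [hT'.2, relaxInternalEnergy, totalEnergy, trace_relaxTensor hm hkB hf,
    hf.kineticEnergy_eq hm]
  ring

/-- Both sides are `3 k_B T / m - tr (P / ρ)` over a temperature. By monotonicity of `ε^I_E`,
`T ≤ T'` when this numerator is positive and `T' ≤ T` when it is negative. -/
theorem relaxTemperature_comparison (hm : 0 < m) (hkB : 0 < kB) (hφ : IsStateDensity φ)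
    (hθ : θ ∈ Icc (0 : ℝ) 1) (hf : IsDistribution φ f) (hT : IsTemperature m kB φ f T)
    (hT' : IsRelaxTemperature m kB φ ν θ f T T') :
    (3 * (kB / m * T) - (covariance m φ f).trace) / (kB / m * T')
      ≤ 3 - (covariance m φ f).trace / (kB / m * T) := by
  have hmono := internalEq_strictMonoOn hm hkB hφ hf.stateMeasure_ne_zero
  have h1 := internalEq_relaxTemperature hm hkB hf hT'
  obtain ⟨hT0, hTe⟩ := hT
  have hT'0 := hT'.1
  rw [totalEnergy, hf.kineticEnergy_eq hm, kineticEq] at hTe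
  set tr := (covariance m φ f).trace
  have hdiff : internalEq m kB φ T' - internalEq m kB φ T
      = 1 / 2 * (1 - θ) * (3 * (kB / m * T) - tr) := by linarith
  have hs : 0 < kB / m * T := by positivity
  have hs' : 0 < kB / m * T' := by positivity
  have hR : 0 < kB / m := by positivity
  have hrw : 3 - tr / (kB / m * T) = (3 * (kB / m * T) - tr) / (kB / m * T) := by
    field_simp
  rw [hrw]
  rcases le_total 0 (3 * (kB / m * T) - tr) with h | h
  · have hle : T ≤ T' := by
      rw [← hmono.le_iff_le hT0 hT'0, ← sub_nonneg, hdiff]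
      have := sub_nonneg.2 hθ.2
      positivity
    exact div_le_div_of_nonneg_left h hs (mul_le_mul_of_nonneg_left hle hR.le)
  · have hle : T' ≤ T := by
      rw [← hmono.le_iff_le hT'0 hT0, ← sub_nonpos, hdiff]
      have := sub_nonneg.2 hθ.2
      exact mul_nonpos_of_nonneg_of_nonpos (by positivity) h
    rw [← neg_le_neg_iff, ← neg_div, ← neg_div]
    exact div_le_div_of_nonneg_left (neg_nonneg.2 h) hs' (mul_le_mul_of_nonneg_left hle hR.le)

/-! ### Entropy production -/

/-- The Gaussian with the covariance of `f` itself, times the internal part of `𝒢`: the density to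
which both `f` and `𝒢` are compared. -/
noncomputable def comparison (m kB : ℝ) (φ : ℝ → ℝ) (f : Phase → ℝ) (T' : ℝ) (p : Phase) : ℝ :=
  gaussGibbs kB φ (∫ q, f q ∂phaseMeasure φ) (velocity m φ f) (covariance m φ f) T' p

/-- An integrable lower bound for the integrand `(f - 𝒢) log f` of the entropy production. -/
noncomputable def minorant (m kB : ℝ) (φ : ℝ → ℝ) (ν θ : ℝ) (f : Phase → ℝ) (T T' : ℝ)
    (p : Phase) : ℝ :=
  f p * Real.log (comparison m kB φ f T' p) - comparison m kB φ f T' p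
    - (gauss m kB φ ν θ f T T' p * Real.log (gauss m kB φ ν θ f T T' p)
      - gauss m kB φ ν θ f T T' p)

theorem minorant_le_of_pos {x G M : ℝ} (hx : 0 < x) (hG : 0 < G) (hM : 0 < M) :
    x * Real.log M - M - (G * Real.log G - G) ≤ -((G - x) * Real.log x) := by
  have h1 := mul_le_mul_of_nonneg_left (Real.log_le_sub_one_of_pos (div_pos hM hx)) hx.le
  have h2 := mul_le_mul_of_nonneg_left (Real.log_le_sub_one_of_pos (div_pos hx hG)) hG.le
  rw [Real.log_div hM.ne' hx.ne', mul_sub_one, mul_div_cancel₀ _ hx.ne'] at h1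
  rw [Real.log_div hx.ne' hG.ne', mul_sub_one, mul_div_cancel₀ _ hG.ne'] at h2
  linarith

theorem minorant_le {x G M : ℝ} (hx : 0 ≤ x) (hG : 0 < G) (hM : 0 < M) :
    ((x * Real.log M - M - (G * Real.log G - G) : ℝ) : EReal)
      ≤ -(((G - x : ℝ) : EReal) * ENNReal.log (ENNReal.ofReal x)) := by
  rcases hx.eq_or_lt with rfl | hx
  · rw [ENNReal.ofReal_zero, ENNReal.log_zero, sub_zero, EReal.coe_mul_bot_of_pos hG,
      EReal.neg_bot]
    exact le_top
  · rw [ENNReal.log_ofReal_of_pos hx, ← EReal.coe_mul, ← EReal.coe_neg, EReal.coe_le_coe_iff]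
    exact minorant_le_of_pos hx hG hM

theorem integrable_gauss_and_integral (hm : 0 < m) (hkB : 0 < kB) (hφ : IsStateDensity φ)
    (hν : ν ∈ Icc (-(1 / 2) : ℝ) 1) (hθ : θ ∈ Icc (0 : ℝ) 1) (hf : IsDistribution φ f)
    (hT : 0 < T) (hT' : 0 < T') :
    Integrable (gauss m kB φ ν θ f T T') (phaseMeasure φ) ∧
      ∫ p, gauss m kB φ ν θ f T T' p ∂phaseMeasure φ = ∫ p, f p ∂phaseMeasure φ := by
  have hS := isCov_relaxTensor hm hkB hν hθ hT hf
  rw [funext (gauss_eq (ν := ν) (θ := θ) (f := f) (kB := kB) (T := T) (T' := T') (φ := φ) hm)]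
  exact ⟨integrable_gaussGibbs hkB hT' hφ hS,
    integral_gaussGibbs hkB hT' hφ hf.stateMeasure_ne_zero hS⟩

theorem integrable_minorant_and_integral_nonneg (hm : 0 < m) (hkB : 0 < kB)
    (hφ : IsStateDensity φ) (hν : ν ∈ Icc (-(1 / 2) : ℝ) 1) (hθ : θ ∈ Icc (0 : ℝ) 1)
    (hf : IsDistribution φ f) (hT : IsTemperature m kB φ f T)
    (hT' : IsRelaxTemperature m kB φ ν θ f T T') :
    Integrable (minorant m kB φ ν θ f T T') (phaseMeasure φ) ∧
      0 ≤ ∫ p, minorant m kB φ ν θ f T T' p ∂phaseMeasure φ := by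
  have h0 := hf.stateMeasure_ne_zero
  have hT0 := hT.1
  have hT'0 := hT'.1
  have hΘ := (hf.posDef_covariance hm).isCov
  have hS := isCov_relaxTensor hm hkB hν hθ hT0 hf
  have hdet := log_det_relaxTensor_ge hm hkB hν hθ hT0 hf
  have hcomp := mul_le_mul_of_nonneg_left
    (relaxTemperature_comparison hm hkB hφ hθ hf hT hT') hθ.1
  have hrel := internalEq_relaxTemperature hm hkB hf hT'
  have hn := hf.pos
  have hρ : density m φ f = m * ∫ p, f p ∂phaseMeasure φ := density_eq m φ f
  have hfI : ∫ p, p.2 * f p ∂phaseMeasure φ = density m φ f * internalEnergy m φ f := by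
    have := hf.density_pos hm
    rw [internalEnergy]
    field_simp
  have hfQ : ∫ p, (p.1 - velocity m φ f) ⬝ᵥ ((covariance m φ f)⁻¹ *ᵥ (p.1 - velocity m φ f)) * f p
      ∂phaseMeasure φ = 3 * ∫ p, f p ∂phaseMeasure φ := by
    have h := hΘ.sum_inv_mul
    have h' : ∀ i j, pressure m φ f i j = density m φ f * covariance m φ f i j := fun i j => by
      have := hf.density_pos hm
      rw [covariance, Matrix.smul_apply, smul_eq_mul]
      field_simp
    rw [hf.integral_quadratic hm]
    simp only [h', mul_left_comm _ (density m φ f), ← Finset.mul_sum]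
    rw [h, hρ, Fintype.card_fin]
    push_cast
    field_simp
  simp only [minorant, comparison, gauss_eq hm]
  set n := ∫ p, f p ∂phaseMeasure φ with hn_def
  set v := velocity m φ f
  set S := relaxTensor m kB φ ν θ f T
  set Θ := covariance m φ f
  have iG := integrable_gaussGibbs (n := n) (v := v) hkB hT'0 hφ hS
  have iM := integrable_gaussGibbs (n := n) (v := v) hkB hT'0 hφ hΘ
  have iGQ := integrable_quadratic_mul_gaussGibbs (n := n) (v := v) hkB hT'0 hφ hS
  have iGI := integrable_energy_mul_gaussGibbs (n := n) (v := v) hkB hT'0 hφ hS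
  have ifQ := hf.integrable_quadratic v Θ⁻¹
  have i1 := integrable_mul_log_gaussGibbs (v := v) hkB hT'0 hφ h0 hn hΘ hf.mass ifQ hf.internal
  have i2 := integrable_mul_log_gaussGibbs (v := v) hkB hT'0 hφ h0 hn hS iG iGQ iGI
  refine ⟨((i1.sub iM).sub (i2.sub iG)).congr (.of_forall fun p => ?_), ?_⟩
  · simp only [minorant, comparison, gauss_eq hm]
    rfl
  have i3 : Integrable (fun p => f p * Real.log (gaussGibbs kB φ n v Θ T' p)
      - gaussGibbs kB φ n v Θ T' p) (phaseMeasure φ) := i1.sub iM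
  have i4 : Integrable (fun p =>
      gaussGibbs kB φ n v S T' p * Real.log (gaussGibbs kB φ n v S T' p)
      - gaussGibbs kB φ n v S T' p) (phaseMeasure φ) := i2.sub iG
  rw [integral_sub i3 i4, integral_sub i1 iM, integral_sub i2 iG,
    integral_mul_log_gaussGibbs hkB hT'0 hφ h0 hn hΘ hf.mass ifQ hf.internal,
    integral_mul_log_gaussGibbs hkB hT'0 hφ h0 hn hS iG iGQ iGI,
    integral_gaussGibbs hkB hT'0 hφ h0 hS, integral_gaussGibbs hkB hT'0 hφ h0 hΘ,
    integral_quadratic_mul_gaussGibbs hkB hT'0 hφ h0 hS, integral_energy_mul_gaussGibbs hm hS,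
    hfQ, hfI, ← hn_def, hρ]
  -- the constants, the masses and the quadratic moments cancel; what remains is `n / 2` times this
  have hkey : 0 ≤ Real.log S.det - Real.log Θ.det
      - θ * ((3 * (kB / m * T) - Θ.trace) / (kB / m * T')) := by linarith
  have hfin := mul_nonneg (half_pos hn).le hkey
  refine hfin.trans_eq ?_
  have hI : internalEq m kB φ T'
      = internalEnergy m φ f + 1 / 2 * θ * (Θ.trace - 3 * (kB / m * T)) := by linarith
  rw [hI]
  simp only [gaussGibbsLogConst]
  field_simp
  ring

theorem extIntegral_production_nonneg (hm : 0 < m) (hkB : 0 < kB)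
    (hφ : IsStateDensity φ) (hν : ν ∈ Icc (-(1 / 2) : ℝ) 1) (hθ : θ ∈ Icc (0 : ℝ) 1)
    (hf : IsDistribution φ f) (hT : IsTemperature m kB φ f T)
    (hT' : IsRelaxTemperature m kB φ ν θ f T T') :
    0 ≤ extIntegral (phaseMeasure φ) fun p =>
      -(((gauss m kB φ ν θ f T T' p - f p : ℝ) : EReal) * ENNReal.log (ENNReal.ofReal (f p))) := by
  obtain ⟨hi, h0⟩ := integrable_minorant_and_integral_nonneg hm hkB hφ hν hθ hf hT hT'
  have hne := hf.stateMeasure_ne_zero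
  refine extIntegral_nonneg_of_minorant hi ?_ h0
  filter_upwards [hf.nonneg] with p hp
  refine minorant_le hp ?_ ?_
  · rw [gauss_eq hm]
    exact gaussGibbs_pos hkB hT'.1 hφ hne hf.pos (isCov_relaxTensor hm hkB hν hθ hT.1 hf) p
  · exact gaussGibbs_pos hkB hT'.1 hφ hne hf.pos (hf.posDef_covariance hm).isCov p

/-- Along a solution, the entropy balance at `(ξ, I)` is the chain rule for
`H'(z) = -k_B (log z + 1)`. -/
theorem entropy_chain_rule {F : ℝ → Vec3 → Phase → ℝ} {q : Phase → ℝ} {t : ℝ} {x : Vec3}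
    (hpos : ∀ (ξ : Vec3) (I : ℝ), 0 < I → 0 < F t x (ξ, I)) (hF : KineticEquationAt F q t x)
    {p : Phase} (hp : 0 < p.2) :
    deriv (fun s => entropyFn kB (F s x p)) t + fderiv ℝ (fun y => entropyFn kB (F t y p)) x p.1
      = -kB * (q p * Real.log (F t x p) + q p) := by
  obtain ⟨ξ, I⟩ := p
  obtain ⟨h1, h2, h3⟩ := hF ξ I hp
  have hne := (hpos ξ I hp).ne'
  have hH : HasDerivAt (entropyFn kB) (-kB * (Real.log (F t x (ξ, I)) + 1)) (F t x (ξ, I)) :=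
    (Real.hasDerivAt_mul_log hne).const_mul (-kB)
  have d1 : deriv (fun s => entropyFn kB (F s x (ξ, I))) t
      = -kB * (Real.log (F t x (ξ, I)) + 1) * deriv (fun s => F s x (ξ, I)) t :=
    (HasDerivAt.comp t (h := fun s => F s x (ξ, I)) hH h1.hasDerivAt).deriv
  have d2 : fderiv ℝ (fun y => entropyFn kB (F t y (ξ, I))) x
      = (-kB * (Real.log (F t x (ξ, I)) + 1)) • fderiv ℝ (fun y => F t y (ξ, I)) x :=
    (HasDerivAt.comp_hasFDerivAt x (f := fun y => F t y (ξ, I)) hH h2.hasFDerivAt).fderiv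
  rw [d1, d2, ← h3]
  simp only [smul_apply, smul_eq_mul]
  ring

end EntropyProduction

end ESBGK

theorem theorem3
    (m kB : ℝ) (hm : 0 < m) (hkB : 0 < kB)
    (φ : ℝ → ℝ) (hφ : ESBGK.IsStateDensity φ)
    (ν θ : ℝ) (hν : ν ∈ Set.Icc (-(1 / 2) : ℝ) 1) (hθ : θ ∈ Set.Icc (0 : ℝ) 1)
    (τES : ℝ → ℝ → ℝ) (hτ : ∀ ρ T : ℝ, 0 < ρ → 0 < T → 0 < τES ρ T)
    (f : ESBGK.Phase → ℝ) (hf : ESBGK.IsDistribution φ f)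
    (T : ℝ) (hT : ESBGK.IsTemperature m kB φ f T)
    (T' : ℝ) (hT' : ESBGK.IsRelaxTemperature m kB φ ν θ f T T') :
    -- the entropy production, as an extended real number, is non-negative
    0 ≤ ESBGK.extProduction m kB φ ν θ τES f T T' ∧
    -- whenever the entropy production is a convergent integral, that integral is non-negative
    ((∀ᵐ p ∂ESBGK.phaseMeasure φ, 0 < f p) →
      MeasureTheory.Integrable
        (fun p => (ESBGK.gauss m kB φ ν θ f T T' p - f p) * Real.log (f p))
        (ESBGK.phaseMeasure φ) →
      ESBGK.extProduction m kB φ ν θ τES f T T'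
        = ((ESBGK.production m kB φ ν θ τES f T T' : ℝ) : EReal) ∧
      0 ≤ ESBGK.production m kB φ ν θ τES f T T' ∧
      -- and it is the source of entropy in the Boltzmann equation
      ∀ (F : ℝ → ESBGK.Vec3 → ESBGK.Phase → ℝ) (t : ℝ) (x : ESBGK.Vec3), F t x = f →
        (∀ (ξ : ESBGK.Vec3) (I : ℝ), 0 < I → 0 < f (ξ, I)) →
        ESBGK.KineticEquationAt F (ESBGK.collision m kB φ ν θ τES f T T') t x →
        ∫ p, (deriv (fun s => ESBGK.entropyFn kB (F s x p)) t
            + fderiv ℝ (fun y => ESBGK.entropyFn kB (F t y p)) x p.1) ∂ESBGK.phaseMeasure φ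
          = ESBGK.production m kB φ ν θ τES f T T') := by
  have hτ0 := hτ _ _ (hf.density_pos hm) hT.1
  have hext : 0 ≤ ESBGK.extProduction m kB φ ν θ τES f T T' :=
    mul_nonneg (by exact_mod_cast (by positivity : 0 ≤ 1 / τES (ESBGK.density m φ f) T * kB))
      (ESBGK.extIntegral_production_nonneg hm hkB hφ hν hθ hf hT hT')
  refine ⟨hext, fun hpos hint => ?_⟩
  have heq : ESBGK.extProduction m kB φ ν θ τES f T T'
      = ((ESBGK.production m kB φ ν θ τES f T T' : ℝ) : EReal) := by
    rw [ESBGK.extProduction, ESBGK.extIntegral_coe hint.neg, ← EReal.coe_mul, ESBGK.production]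
    · simp only [Pi.neg_apply, integral_neg]
      congr 1
      ring
    · filter_upwards [hpos] with p hp
      rw [ENNReal.log_ofReal_of_pos hp, ← EReal.coe_mul, ← EReal.coe_neg, Pi.neg_apply]
  refine ⟨heq, by rw [heq] at hext; exact_mod_cast hext, ?_⟩
  rintro F t x rfl hfpos hF
  obtain ⟨hG, hGf⟩ :=
    ESBGK.integrable_gauss_and_integral hm hkB hφ hν hθ hf hT.1 hT'.1
  have hGsub : MeasureTheory.Integrable
      (fun p => ESBGK.gauss m kB φ ν θ (F t x) T T' p - F t x p) (ESBGK.phaseMeasure φ) :=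
    hG.sub hf.mass
  rw [integral_congr_ae (g := fun p => -kB * (1 / τES (ESBGK.density m φ (F t x)) T) *
    ((ESBGK.gauss m kB φ ν θ (F t x) T T' p - F t x p) * Real.log (F t x p)
      + (ESBGK.gauss m kB φ ν θ (F t x) T T' p - F t x p)))]
  · -- the term without logarithm integrates to zero, because `𝒢` and `f` have the same mass
    rw [integral_const_mul, integral_add hint hGsub, integral_sub hG hf.mass, hGf,
      sub_self, add_zero, ESBGK.production]
    ring
  · filter_upwards [ESBGK.ae_phaseMeasure_pos φ] with p hp
    rw [ESBGK.entropy_chain_rule hfpos hF hp, ESBGK.collision]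
    ring
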